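/- Let $M$ be a smooth manifold (finite-dimensional, Hausdorff, second countable, without boundary) with a $\theta$-almost twisted Poisson structure $(\Lambda,\varphi,\theta)$: a bivector field $\Lambda$, a 3-form $\varphi$ and a closed 1-form $\theta$ on $M$ such that $$d\varphi=\theta\wedge\varphi,\qquad \Lambda^\#(\theta)=0,\qquad \tfrac12[\Lambda,\Lambda]=\Lambda^\#(\varphi).$$ Here $\beta(\Lambda^\#(\alpha))=\Lambda(\alpha,\beta)$ for 1-forms $\alpha,\beta$; $\Lambda^\#(\psi)(\alpha_1,\dots,\alpha_k)=(-1)^k\psi(\Lambda^\#(\alpha_1),\dots,\Lambda^\#(\alpha_k))$ for a $k$-form $\psi$; and $[\cdot,\cdot]$ is the Schouten–Nijenhuis bracket of multivector fields, with the sign convention for which $[X,\cdot]=\mathcal L_X$ for vector fields $X$, $[P,Q]=-(-1)^{(p-1)(q-1)}[Q,P]$ and $[P,Q\wedge R]=[P,Q]\wedge R+(-1)^{(p-1)q}Q\wedge[P,R]$, where $p,q$ are the degrees of $P,Q$. On 1-forms put $$[\alpha,\beta]_{\varphi,\theta}=\mathcal L_{\Lambda^\#(\alpha)}\beta-\mathcal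 L_{\Lambda^\#(\beta)}\alpha-d(\Lambda(\alpha,\beta))+i_{\Lambda^\#(\beta)}i_{\Lambda^\#(\alpha)}\varphi+\Lambda(\alpha,\beta)\,\theta .$$ For a complex $n$-vector field $v=v_1+iv_2$ ($v_1,v_2$ real $n$-vector fields) let $\partial_{\varphi,\theta}v$ be given by $$(\partial_{\varphi,\theta}v)(\alpha_1,\dots,\alpha_{n+1})=\sum_{i=1}^{n+1}(-1)^{i-1}\Lambda^\#(\alpha_i)\bigl(v(\alpha_1,\dots,\widehat{\alpha_i},\dots,\alpha_{n+1})\bigr)+\sum_{1\le i<j\le n+1}(-1)^{i+j}v\bigl([\alpha_i,\alpha_j]_{\varphi,\theta},\alpha_1,\dots,\widehat{\alpha_i},\dots,\widehat{\alpha_j},\dots,\alpha_{n+1}\bigr)$$ for all 1-forms $\alpha_1,\dots,\alpha_{n+1}$. The complex $\theta$-almost twisted Poisson cohomology $H^n$ of $M$ is the space of complex $n$-vector fields $v$ with $\partial_{\varphi,\theta}v=0$ modulo those of the form $\partial_{\varphi,\theta}u$ with $u$ a complex $(n-1)$-vector field. Let $K\to M$ be a smooth complex line bundle. A contravariant derivative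 on $K$ is an $\mathbb R$-linear map $D:\Omega^1(M)\to\operatorname{End}_{\mathbb C}(\Gamma(K))$ with $D_{f\alpha}s=f D_\alpha s$ and $D_\alpha(fs)=fD_\alpha s+\Lambda^\#(\alpha)(f)\,s$ for all $f\in C^\infty(M)$ (real-valued), $\alpha\in\Omega^1(M)$ and $s\in\Gamma(K)$. Its curvature is $C_D(\alpha,\beta)=D_\alpha D_\beta-D_\beta D_\alpha-D_{[\alpha,\beta]_{\varphi,\theta}}$. **Theorem.** For every contravariant derivative $D$ on $K$ there is a unique complex bivector field $P_{C_D}$ on $M$ with $C_D(\alpha,\beta)s=P_{C_D}(\alpha,\beta)\,s$ for all 1-forms $\alpha,\beta$ and all $s\in\Gamma(K)$. Moreover: (i) $\partial_{\varphi,\theta}P_{C_D}=0$, so $P_{C_D}$ defines a class $[P_{C_D}]$ in $H^2$. (ii) This class does not depend on $D$: if $D$ and $D'$ are contravariant derivatives on $K$, then $[P_{C_D}]=[P_{C_{D'}}]$. (iii) If $D$ is compatible with a smooth Hermitian metric $h$ on $K$, that is, $\Lambda^\#(\alpha)(h(s,t))=h(D_\alpha s,t)+h(s,D_\alpha t)$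 for all $\alpha\in\Omega^1(M)$ and $s,t\in\Gamma(K)$, then $P_{C_D}$ is purely imaginary, i.e. its real part is zero. -/

import Mathlib

open scoped Manifold ContDiff

noncomputable section

namespace AlmostTwistedPoisson

section Fields

variable (E : Type*) [NormedAddCommGroup E] [NormedSpace ℝ E]
  (M : Type*) [TopologicalSpace M] [ChartedSpace E M] [IsManifold 𝓘(ℝ, E) ∞ M]

/-- Real-valued smooth functions on `M`. -/
abbrev SmoothFun := ContMDiffMap 𝓘(ℝ, E) 𝓘(ℝ, ℝ) M ℝ ∞

/-- Smooth vector fields: smooth sections of the tangent bundle. -/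
abbrev VField := ContMDiffSection 𝓘(ℝ, E) E ∞ (fun x : M => TangentSpace 𝓘(ℝ, E) x)

/-- Smooth 1-forms: smooth sections of the cotangent bundle. -/
abbrev OneForm :=
  ContMDiffSection 𝓘(ℝ, E) (E →L[ℝ] ℝ) ∞ (fun x : M => TangentSpace 𝓘(ℝ, E) x →L[ℝ] ℝ)

end Fields

section SmoothnessCriteria

variable {E : Type*} [NormedAddCommGroup E] [NormedSpace ℝ E]
  {M : Type*} [TopologicalSpace M] [ChartedSpace E M] [IsManifold 𝓘(ℝ, E) ∞ M]

theorem contMDiff_pairing (a : OneForm E M) (Z : VField E M) :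
    ContMDiff 𝓘(ℝ, E) 𝓘(ℝ, ℝ) ∞ (fun x => a x (Z x)) := by
  have h := ContMDiff.clm_bundle_apply (b := fun x : M => x) (E₂ := fun _ : M => ℝ)
    (ϕ := fun x => a x) (v := fun x => Z x) a.contMDiff Z.contMDiff
  intro x
  exact ((Bundle.contMDiffAt_section x).mp (h x))

theorem contMDiff_mvfderiv (f : SmoothFun E M) :
    ContMDiff 𝓘(ℝ, E) (𝓘(ℝ, E).prod 𝓘(ℝ, E →L[ℝ] ℝ)) ∞
      (fun x => Bundle.TotalSpace.mk' (E →L[ℝ] ℝ)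
        (E := fun x : M => TangentSpace 𝓘(ℝ, E) x →L[ℝ] ℝ) x (mvfderiv 𝓘(ℝ, E) f x)) := by
  intro x₀
  rw [contMDiffAt_hom_bundle]
  refine ⟨contMDiffAt_id, ?_⟩
  have h := (f.contMDiff x₀).mfderiv_const (m := ∞) (by simp)
  refine h.congr_of_eventuallyEq (Filter.Eventually.of_forall fun x => ?_)
  ext v
  simp [inTangentCoordinates, ContinuousLinearMap.inCoordinates, mvfderiv]
  rfl

variable [FiniteDimensional ℝ E]

/-- The coframe dual to the local frame given by a trivialization of the tangent bundle. -/
def coframe (x₀ : M) (i : Fin (Module.finrank ℝ E)) (x : M) :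
    TangentSpace 𝓘(ℝ, E) x →L[ℝ] ℝ :=
  (LinearMap.toContinuousLinearMap ((Module.finBasis ℝ E).coord i)).comp
    ((trivializationAt E (TangentSpace 𝓘(ℝ, E) : M → Type _) x₀).continuousLinearMapAt ℝ x)

theorem contMDiffOn_coframe (x₀ : M) (i : Fin (Module.finrank ℝ E)) :
    ContMDiffOn 𝓘(ℝ, E) (𝓘(ℝ, E).prod 𝓘(ℝ, E →L[ℝ] ℝ)) ∞
      (fun x => Bundle.TotalSpace.mk' (E →L[ℝ] ℝ)
        (E := fun x : M => TangentSpace 𝓘(ℝ, E) x →L[ℝ] ℝ) x (coframe x₀ i x))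
      (trivializationAt E (TangentSpace 𝓘(ℝ, E) : M → Type _) x₀).baseSet := by
  intro y hy
  apply ContMDiffAt.contMDiffWithinAt
  rw [contMDiffAt_hom_bundle]
  refine ⟨contMDiffAt_id, ?_⟩
  set e := trivializationAt E (TangentSpace 𝓘(ℝ, E) : M → Type _) x₀
  set e' := trivializationAt E (TangentSpace 𝓘(ℝ, E) : M → Type _) y
  have hy' : y ∈ e'.baseSet := FiberBundle.mem_baseSet_trivializationAt' y
  have h := contMDiffAt_coordChangeL (IB := 𝓘(ℝ, E)) (n := ∞) (e := e') (e' := e) hy' hy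
  have h2 := (contMDiffAt_const (I := 𝓘(ℝ, E)) (n := ∞) (x := y)
    (c := LinearMap.toContinuousLinearMap ((Module.finBasis ℝ E).coord i))).clm_comp h
  refine h2.congr_of_eventuallyEq ?_
  filter_upwards [e.open_baseSet.mem_nhds hy, e'.open_baseSet.mem_nhds hy'] with b hb hb'
  ext v
  rw [ContinuousLinearMap.inCoordinates_eq hb' (by simp)]
  have h3 := e'.coordChangeL_apply (R := ℝ) e ⟨hb', hb⟩ v
  have h4 : e.linearMapAt ℝ b (e'.symm b v) = (e ⟨b, e'.symm b v⟩).2 := by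
    rw [e.coe_linearMapAt_of_mem hb]
  simp only [ContinuousLinearMap.coe_comp, Function.comp_apply, ContinuousLinearEquiv.coe_coe, h3]
  rw [← h4]
  simp [coframe, e, e']

/-- A covector field is smooth as soon as its pairing with every smooth vector field is smooth. -/
theorem contMDiff_of_pairing [T2Space M] (a : ∀ x : M, TangentSpace 𝓘(ℝ, E) x →L[ℝ] ℝ)
    (h : ∀ Z : VField E M, ContMDiff 𝓘(ℝ, E) 𝓘(ℝ, ℝ) ∞ (fun x => a x (Z x))) :
    ContMDiff 𝓘(ℝ, E) (𝓘(ℝ, E).prod 𝓘(ℝ, E →L[ℝ] ℝ)) ∞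
      (fun x => Bundle.TotalSpace.mk' (E →L[ℝ] ℝ)
        (E := fun x : M => TangentSpace 𝓘(ℝ, E) x →L[ℝ] ℝ) x (a x)) := by
  intro x₀
  set e := trivializationAt E (TangentSpace 𝓘(ℝ, E) : M → Type _) x₀ with he
  have hx₀ : x₀ ∈ e.baseSet := FiberBundle.mem_baseSet_trivializationAt' x₀
  have hU := e.open_baseSet.mem_nhds hx₀
  let b := Module.finBasis ℝ E
  obtain ⟨ψ, hψ, -⟩ := (SmoothBumpFunction.nhds_basis_support (I := 𝓘(ℝ, E)) hU).mem_iff.mp hU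
  have hloc : ∀ i, ContMDiffAt 𝓘(ℝ, E) 𝓘(ℝ, ℝ) ∞ (fun x => a x (e.localFrame b i x)) x₀ := by
    intro i
    have hs : ContMDiff 𝓘(ℝ, E) (𝓘(ℝ, E).prod 𝓘(ℝ, E)) ∞
        (fun x => Bundle.TotalSpace.mk' E x (((ψ : M → ℝ) • e.localFrame b i) x)) :=
      ContMDiffOn.smul_section_of_tsupport (u := e.baseSet) ψ.contMDiff.contMDiffOn
        e.open_baseSet hψ (e.contMDiffOn_localFrame_baseSet ∞ b i)
    refine (h ⟨_, hs⟩ x₀).congr_of_eventuallyEq ?_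
    filter_upwards [ψ.eventuallyEq_one] with x hx
    simp [hx]
  have hsum : ContMDiffAt 𝓘(ℝ, E) (𝓘(ℝ, E).prod 𝓘(ℝ, E →L[ℝ] ℝ)) ∞
      (fun x => Bundle.TotalSpace.mk' (E →L[ℝ] ℝ)
        (E := fun x : M => TangentSpace 𝓘(ℝ, E) x →L[ℝ] ℝ) x
        (∑ i, ((fun x => a x (e.localFrame b i x)) • (coframe x₀ i)) x)) x₀ := by
    apply ContMDiffAt.sum_section
    intro i _
    exact (hloc i).smul_section ((contMDiffOn_coframe x₀ i).contMDiffAt hU)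
  refine hsum.congr_of_eventuallyEq ?_
  filter_upwards [hU] with x hx
  congr 1
  ext v
  have hv : v = ∑ i, coframe x₀ i x v • e.localFrame b i x := by
    have h1 := e.symmL_continuousLinearMapAt (R := ℝ) hx v
    rw [← b.sum_repr (e.continuousLinearMapAt ℝ x v), map_sum] at h1
    refine h1.symm.trans (Finset.sum_congr rfl fun i _ => ?_)
    rw [map_smul, e.localFrame_apply_of_mem_baseSet b hx]
    congr 1
    simp [Bundle.Trivialization.basisAt, hx]
  have h2 := congrArg (a x) hv
  rw [map_sum] at h2
  simp only [map_smul, smul_eq_mul] at h2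
  rw [h2]
  simp [mul_comm]

/-- A tangent vector field is smooth as soon as its pairing with every smooth 1-form is smooth. -/
theorem contMDiff_vector_of_pairing [T2Space M] (X : ∀ x : M, TangentSpace 𝓘(ℝ, E) x)
    (h : ∀ a : OneForm E M, ContMDiff 𝓘(ℝ, E) 𝓘(ℝ, ℝ) ∞ (fun x => a x (X x))) :
    ContMDiff 𝓘(ℝ, E) (𝓘(ℝ, E).prod 𝓘(ℝ, E)) ∞
      (fun x => Bundle.TotalSpace.mk' E (E := fun x : M => TangentSpace 𝓘(ℝ, E) x) x (X x)) := by
  intro x₀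
  set e := trivializationAt E (TangentSpace 𝓘(ℝ, E) : M → Type _) x₀ with he
  have hx₀ : x₀ ∈ e.baseSet := FiberBundle.mem_baseSet_trivializationAt' x₀
  have hU := e.open_baseSet.mem_nhds hx₀
  let b := Module.finBasis ℝ E
  obtain ⟨ψ, hψ, -⟩ := (SmoothBumpFunction.nhds_basis_support (I := 𝓘(ℝ, E)) hU).mem_iff.mp hU
  have hloc : ∀ i, ContMDiffAt 𝓘(ℝ, E) 𝓘(ℝ, ℝ) ∞ (fun x => coframe x₀ i x (X x)) x₀ := by
    intro i
    have hs : ContMDiff 𝓘(ℝ, E) (𝓘(ℝ, E).prod 𝓘(ℝ, E →L[ℝ] ℝ)) ∞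
        (fun x => Bundle.TotalSpace.mk' (E →L[ℝ] ℝ)
          (E := fun x : M => TangentSpace 𝓘(ℝ, E) x →L[ℝ] ℝ) x
          (((ψ : M → ℝ) • coframe x₀ i) x)) :=
      ContMDiffOn.smul_section_of_tsupport (u := e.baseSet) ψ.contMDiff.contMDiffOn
        e.open_baseSet hψ (contMDiffOn_coframe x₀ i)
    refine (h ⟨_, hs⟩ x₀).congr_of_eventuallyEq ?_
    filter_upwards [ψ.eventuallyEq_one] with x hx
    simp [hx]
  rw [e.contMDiffAt_section_iff hx₀]
  have hsum : ContMDiffAt 𝓘(ℝ, E) 𝓘(ℝ, E) ∞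
      (fun x => ∑ i, coframe x₀ i x (X x) • b i) x₀ := by
    apply contMDiffAt_finsetSum
    intro i _
    exact (hloc i).smul contMDiffAt_const
  refine hsum.congr_of_eventuallyEq ?_
  filter_upwards [hU] with x hx
  have h1 := b.sum_repr (e.continuousLinearMapAt ℝ x (X x))
  refine Eq.trans ?_ h1.symm
  simp [hx]

end SmoothnessCriteria

section Calculus

variable {E : Type*} [NormedAddCommGroup E] [NormedSpace ℝ E] [FiniteDimensional ℝ E]
  {M : Type*} [TopologicalSpace M] [ChartedSpace E M] [IsManifold 𝓘(ℝ, E) ∞ M]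

instance (x : M) : FiniteDimensional ℝ (TangentSpace 𝓘(ℝ, E) x) :=
  inferInstanceAs (FiniteDimensional ℝ E)

instance (x : M) : T2Space (TangentSpace 𝓘(ℝ, E) x) := inferInstanceAs (T2Space E)

/-- The differential `df` of a smooth function. -/
def diff (f : SmoothFun E M) : OneForm E M :=
  ⟨fun x => mvfderiv 𝓘(ℝ, E) f x, contMDiff_mvfderiv f⟩

/-- The smooth function `a(Z)`. -/
def pairing (a : OneForm E M) (Z : VField E M) : SmoothFun E M :=
  ⟨fun x => a x (Z x), contMDiff_pairing a Z⟩

/-- The product of a smooth section of a vector bundle with a smooth real function. -/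
def fsmul {F : Type*} [NormedAddCommGroup F] [NormedSpace ℝ F] {V : M → Type*}
    [TopologicalSpace (Bundle.TotalSpace F V)] [∀ x, TopologicalSpace (V x)] [FiberBundle F V]
    [∀ x, AddCommGroup (V x)] [∀ x, Module ℝ (V x)] [VectorBundle ℝ F V]
    (f : SmoothFun E M) (s : ContMDiffSection 𝓘(ℝ, E) F ∞ V) : ContMDiffSection 𝓘(ℝ, E) F ∞ V :=
  ⟨fun x => f x • s x, f.contMDiff.smul_section s.contMDiff⟩

/-- The operation `Z ↦ X(β(Z)) - β([X, Z])` at the point `x`. -/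
def lieDerivAux (X : VField E M) (β : OneForm E M) (x : M)
    (Z : ∀ y : M, TangentSpace 𝓘(ℝ, E) y) : ℝ :=
  mvfderiv 𝓘(ℝ, E) (fun y => β y (Z y)) x (X x) -
    β x (VectorField.mlieBracket 𝓘(ℝ, E) X Z x)

theorem tensorialAt_lieDerivAux (X : VField E M) (β : OneForm E M) (x : M) :
    TensorialAt 𝓘(ℝ, E) E (lieDerivAux X β x) x := by
  have hβ : ∀ {σ : ∀ y : M, TangentSpace 𝓘(ℝ, E) y},
      MDifferentiableAt 𝓘(ℝ, E) (𝓘(ℝ, E).prod 𝓘(ℝ, E))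
        (fun y => Bundle.TotalSpace.mk' E (E := fun y : M => TangentSpace 𝓘(ℝ, E) y) y (σ y)) x →
      MDifferentiableAt 𝓘(ℝ, E) 𝓘(ℝ, ℝ) (fun y => β y (σ y)) x := by
    intro σ hσ
    have h := MDifferentiableAt.clm_bundle_apply (b := fun x : M => x) (E₂ := fun _ : M => ℝ)
      (ϕ := fun x => β x) (v := σ) β.mdifferentiableAt hσ
    exact (mdifferentiableAt_section _ _).mp h
  constructor
  · intro f σ hf hσ
    have h1 : (fun y => β y ((f • σ) y)) = f * fun y => β y (σ y) := by
      ext y; simp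
    simp only [lieDerivAux]
    rw [h1, mvfderiv_mul hf (hβ hσ), VectorField.mlieBracket_smul_right hf hσ]
    simp
    ring
  · intro σ σ' hσ hσ'
    have h1 : (fun y => β y ((σ + σ') y)) = (fun y => β y (σ y)) + fun y => β y (σ' y) := by
      ext y; simp
    simp only [lieDerivAux]
    rw [h1, mvfderiv_add (hβ hσ) (hβ hσ'), VectorField.mlieBracket_add_right hσ hσ']
    simp
    ring

theorem mkHom_lieDerivAux (X : VField E M) (β : OneForm E M) (Z : VField E M) (x : M) :
    TensorialAt.mkHom (lieDerivAux X β x) x (tensorialAt_lieDerivAux X β x) (Z x) =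
      lieDerivAux X β x Z :=
  TensorialAt.mkHom_apply _ Z.mdifferentiableAt

theorem contMDiff_mlieBracket (X Z : VField E M) :
    ContMDiff 𝓘(ℝ, E) (𝓘(ℝ, E).prod 𝓘(ℝ, E)) ∞
      (fun x => Bundle.TotalSpace.mk' E (E := fun x : M => TangentSpace 𝓘(ℝ, E) x) x
        (VectorField.mlieBracket 𝓘(ℝ, E) X Z x)) :=
  have h1 : IsManifold 𝓘(ℝ, E) (minSmoothness ℝ 2) M :=
    IsManifold.of_le (n := ∞) (by simpa using! (ENat.LEInfty.out : (2 : ℕ∞ω) ≤ ∞))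
  have h2 : IsManifold 𝓘(ℝ, E) (((⊤ : ℕ∞) : ℕ∞ω) + 1) M := by simpa using! ‹IsManifold 𝓘(ℝ, E) ∞ M›
  ContDiff.mlieBracket_vectorField (m := ⊤) (n := ⊤) X.contMDiff Z.contMDiff (by simp)

/-- The Lie bracket of vector fields. -/
def lieBracket (X Z : VField E M) : VField E M :=
  ⟨VectorField.mlieBracket 𝓘(ℝ, E) X Z, contMDiff_mlieBracket X Z⟩

variable (E M) in
/-- Not necessarily smooth `n`-vector fields with values in `F`: fields of alternating `n`-linear
maps on the cotangent spaces. -/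
def RawMultiVec (F : Type*) [NormedField F] [NormedAlgebra ℝ F] (n : ℕ) : Type _ :=
  ∀ x : M, (TangentSpace 𝓘(ℝ, E) x →L[ℝ] ℝ) [⋀^Fin n]→ₗ[ℝ] F

instance (F : Type*) [NormedField F] [NormedAlgebra ℝ F] (n : ℕ) :
    AddCommGroup (RawMultiVec E M F n) := Pi.addCommGroup

instance (F : Type*) [NormedField F] [NormedAlgebra ℝ F] (n : ℕ) :
    Module F (RawMultiVec E M F n) := Pi.module _ _ _

variable (E M) in
/-- Smooth `n`-vector fields with values in `F`: those whose values on smooth 1-forms are smooth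
functions. For `F = ℝ` these are the real `n`-vector fields, and for `F = ℂ` the complex ones
`P₁ + i P₂`. -/
def MultiVec (F : Type*) [NormedField F] [NormedAlgebra ℝ F] (n : ℕ) :
    Submodule F (RawMultiVec E M F n) where
  carrier := {v | ∀ α : Fin n → OneForm E M,
    ContMDiff 𝓘(ℝ, E) 𝓘(ℝ, F) ∞ (fun x => v x (fun i => α i x))}
  add_mem' hv hw α := (hv α).add (hw α)
  zero_mem' _ := contMDiff_const
  smul_mem' c v hv α := by
    have h : ContDiff ℝ ∞ (fun z : F => c * z) := contDiff_const.mul contDiff_id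
    exact h.contMDiff.comp (hv α)

/-- The smooth function `P(α₁, …, αₙ)`. -/
def evalForms {n : ℕ} (P : MultiVec E M ℝ n) (α : Fin n → OneForm E M) : SmoothFun E M :=
  ⟨fun x => P.1 x (fun i => α i x), P.2 α⟩

/-- A bivector at a point as a bilinear form on the cotangent space. -/
def bilinAt (Λ : MultiVec E M ℝ 2) (x : M) :
    (TangentSpace 𝓘(ℝ, E) x →L[ℝ] ℝ) →ₗ[ℝ] (TangentSpace 𝓘(ℝ, E) x →L[ℝ] ℝ) →ₗ[ℝ] ℝ :=
  have hu : ∀ a b : TangentSpace 𝓘(ℝ, E) x →L[ℝ] ℝ, Function.update ![a, 0] 1 b = ![a, b] := by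
    intro a b
    ext i
    fin_cases i <;> simp
  LinearMap.mk₂ ℝ (fun α β => Λ.1 x ![α, β])
    (fun α α' β => (Λ.1 x).map_vecCons_add ![β] α α')
    (fun c α β => (Λ.1 x).map_vecCons_smul ![β] c α)
    (fun α β β' => by
      have h := (Λ.1 x).map_update_add ![α, 0] 1 β β'
      rwa [hu, hu, hu] at h)
    (fun c α β => by
      have h := (Λ.1 x).map_update_smul ![α, 0] 1 c β
      rwa [hu, hu] at h)

/-- The map `Λ^# : T*_x M → T_x M`, characterized by `β(Λ^#(α)) = Λ(α, β)`. -/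
def sharpAt (Λ : MultiVec E M ℝ 2) (x : M) :
    (TangentSpace 𝓘(ℝ, E) x →L[ℝ] ℝ) →ₗ[ℝ] TangentSpace 𝓘(ℝ, E) x :=
  (Module.evalEquiv ℝ (TangentSpace 𝓘(ℝ, E) x)).symm.toLinearMap ∘ₗ
    (LinearMap.lcomp ℝ ℝ (LinearMap.toContinuousLinearMap
      (𝕜 := ℝ) (E := TangentSpace 𝓘(ℝ, E) x) (F' := ℝ)).toLinearMap) ∘ₗ bilinAt Λ x

theorem apply_sharpAt (Λ : MultiVec E M ℝ 2) (x : M)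
    (α β : TangentSpace 𝓘(ℝ, E) x →L[ℝ] ℝ) : β (sharpAt Λ x α) = Λ.1 x ![α, β] :=
  Module.apply_evalEquiv_symm_apply ℝ (TangentSpace 𝓘(ℝ, E) x) (β : _ →ₗ[ℝ] ℝ) _

variable [T2Space M]

/-- The Lie derivative `L_X β` of a 1-form: `(L_X β)(Z) = X(β(Z)) - β([X, Z])`. -/
def lieDeriv (X : VField E M) (β : OneForm E M) : OneForm E M :=
  ⟨fun x => TensorialAt.mkHom (lieDerivAux X β x) x (tensorialAt_lieDerivAux X β x), by
    apply contMDiff_of_pairing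
    intro Z
    simp only [mkHom_lieDerivAux]
    exact (contMDiff_pairing (diff (pairing β Z)) X).sub
      (contMDiff_pairing β (lieBracket X Z))⟩

variable (E M) in
/-- A smooth differential `k`-form: a field of alternating `k`-linear forms on the tangent spaces
whose values on smooth vector fields are smooth functions. -/
structure KForm (k : ℕ) where
  toFun : ∀ x : M, (TangentSpace 𝓘(ℝ, E) x) [⋀^Fin k]→ₗ[ℝ] ℝ
  smooth' : ∀ X : Fin k → VField E M,
    ContMDiff 𝓘(ℝ, E) 𝓘(ℝ, ℝ) ∞ (fun x => toFun x (fun i => X i x))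

instance (k : ℕ) : CoeFun (KForm E M k)
    (fun _ => ∀ x : M, (TangentSpace 𝓘(ℝ, E) x) [⋀^Fin k]→ₗ[ℝ] ℝ) :=
  ⟨KForm.toFun⟩

/-- The interior product `i_X ψ = ψ(X, …)`. -/
def KForm.interior {k : ℕ} (X : VField E M) (ψ : KForm E M (k + 1)) : KForm E M k :=
  ⟨fun x => (ψ x).curryLeft (X x), fun Y => by
    refine (ψ.smooth' (Matrix.vecCons X Y)).congr fun x => ?_
    simp only [AlternatingMap.curryLeft_apply_apply]
    congr 1
    ext i
    refine Fin.cases ?_ (fun i => ?_) i <;> simp⟩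

/-- A `1`-form in the sense of `KForm`, seen as a smooth section of the cotangent bundle. -/
def KForm.toOneForm (ψ : KForm E M 1) : OneForm E M :=
  ⟨fun x => LinearMap.toContinuousLinearMap
      ((AlternatingMap.ofSubsingleton ℝ (TangentSpace 𝓘(ℝ, E) x) ℝ (0 : Fin 1)).symm (ψ x)), by
    apply contMDiff_of_pairing
    intro Z
    exact ψ.smooth' (fun _ => Z)⟩

/-- The exterior derivative of a `(k+1)`-form, evaluated on vector fields `X₀, …, X_{k+1}`. -/
def KForm.extDeriv {k : ℕ} (ψ : KForm E M (k + 1)) (X : Fin (k + 2) → VField E M) (x : M) : ℝ :=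
  (∑ i : Fin (k + 2), (-1 : ℝ) ^ (i : ℕ) *
      mvfderiv 𝓘(ℝ, E) (fun y => ψ y (fun l => X (i.succAbove l) y)) x (X i x)) +
    ∑ j : Fin (k + 2), ∑ i : Fin (k + 1), if i.castSucc < j then
      (-1 : ℝ) ^ ((i : ℕ) + (j : ℕ)) * ψ x (Matrix.vecCons (lieBracket (X i.castSucc) (X j) x)
        (fun l => X (j.succAbove (i.succAbove l)) x)) else 0

/-- The wedge product `θ ∧ ψ` of a 1-form and a `k`-form, evaluated on vector fields. -/
def KForm.oneWedge {k : ℕ} (θ : OneForm E M) (ψ : KForm E M k) (X : Fin (k + 1) → VField E M)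
    (x : M) : ℝ :=
  ∑ i : Fin (k + 1), (-1 : ℝ) ^ (i : ℕ) * (θ x (X i x) * ψ x (fun l => X (i.succAbove l) x))

/-- A 1-form `θ` is closed if `dθ(X, Y) = X(θ(Y)) - Y(θ(X)) - θ([X, Y])` vanishes. -/
def IsClosedOneForm (θ : OneForm E M) : Prop :=
  ∀ (X Y : VField E M) (x : M),
    mvfderiv 𝓘(ℝ, E) (pairing θ Y) x (X x) - mvfderiv 𝓘(ℝ, E) (pairing θ X) x (Y x) -
      θ x (lieBracket X Y x) = 0

/-- The vector field `Λ^#(α)`. -/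
def sharp (Λ : MultiVec E M ℝ 2) (α : OneForm E M) : VField E M :=
  ⟨fun x => sharpAt Λ x (α x), by
    apply contMDiff_vector_of_pairing
    intro β
    simp only [apply_sharpAt]
    refine (Λ.2 ![α, β]).congr fun x => ?_
    congr 1
    ext i
    fin_cases i <;> rfl⟩

/-- The `k`-vector field `Λ^#(ψ)(α₁, …, α_k) = (-1)^k ψ(Λ^#(α₁), …, Λ^#(α_k))`. -/
def sharpForm (Λ : MultiVec E M ℝ 2) {k : ℕ} (ψ : KForm E M k) : MultiVec E M ℝ k :=
  ⟨fun x => (-1 : ℝ) ^ k • (ψ x).compLinearMap (sharpAt Λ x), fun α =>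
    contMDiff_const.mul (ψ.smooth' (fun i => sharp Λ (α i)))⟩

/-- The Koszul bracket `L_{Λ^#(α)} β - L_{Λ^#(β)} α - d(Λ(α, β))` of 1-forms. -/
def koszulBracket (Λ : MultiVec E M ℝ 2) (α β : OneForm E M) : OneForm E M :=
  lieDeriv (sharp Λ α) β - lieDeriv (sharp Λ β) α - diff (evalForms Λ ![α, β])

/-- Insertion of the multivector field `Q` of degree `q + 1` into the multivector field `P` of
degree `p + 1`, both regarded as skew-symmetric multiderivations of the algebra of smooth functions:
the sum over all `(q + 1, p)`-shuffles `σ` of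
`sgn(σ) P(Q(f_{σ(0)}, …, f_{σ(q)}), f_{σ(q+1)}, …, f_{σ(q+p)})`.
It is written as a sum over all permutations, divided by `(q + 1)! p!`. -/
def insertion {p q N : ℕ} (hN : N = q + 1 + p) (P : MultiVec E M ℝ (p + 1))
    (Q : MultiVec E M ℝ (q + 1)) (f : Fin N → SmoothFun E M) (x : M) : ℝ :=
  ((q + 1).factorial * p.factorial : ℝ)⁻¹ * ∑ σ : Equiv.Perm (Fin N),
    ((Equiv.Perm.sign σ : ℤ) : ℝ) * evalForms P (Matrix.vecCons
      (diff (evalForms Q fun i => diff (f (σ ((i.castAdd p).cast hN.symm)))))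
      (fun i => diff (f (σ ((i.natAdd (q + 1)).cast hN.symm))))) x

/-- The Schouten-Nijenhuis bracket of multivector fields `P`, `Q` of degrees `p + 1`, `q + 1`,
evaluated on the differentials of `p + q + 1` functions (a multivector field is determined by such
values). The signs are those for which the bracket with a vector field `X` (the case `p = 0`) is the
Lie derivative, `[P, Q] = -(-1)^{pq} [Q, P]` and
`[P, Q ∧ R] = [P, Q] ∧ R + (-1)^{p(q+1)} Q ∧ [P, R]`. -/
def schouten {p q : ℕ} (P : MultiVec E M ℝ (p + 1)) (Q : MultiVec E M ℝ (q + 1))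
    (f : Fin (p + q + 1) → SmoothFun E M) (x : M) : ℝ :=
  (-1 : ℝ) ^ (p * q) * insertion (by omega) P Q f x - insertion (by omega) Q P f x

end Calculus

section Structure

variable (E : Type*) [NormedAddCommGroup E] [NormedSpace ℝ E] [FiniteDimensional ℝ E]
  (M : Type*) [TopologicalSpace M] [ChartedSpace E M] [IsManifold 𝓘(ℝ, E) ∞ M] [T2Space M]

/-- A `θ`-almost twisted Poisson structure `(Λ, φ, θ)` on `M`: a bivector field `Λ`, a 3-form `φ`
and a closed 1-form `θ` with `dφ = θ ∧ φ`, `Λ^#(θ) = 0` and `½ [Λ, Λ] = Λ^#(φ)`. -/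
structure ATPStructure where
  Λ : MultiVec E M ℝ 2
  φ : KForm E M 3
  θ : OneForm E M
  closed_θ : IsClosedOneForm θ
  extDeriv_φ : ∀ (X : Fin 4 → VField E M) (x : M), φ.extDeriv X x = KForm.oneWedge θ φ X x
  sharp_θ : sharp Λ θ = 0
  schouten_Λ : ∀ (f : Fin 3 → SmoothFun E M) (x : M),
    (1 / 2 : ℝ) * schouten Λ Λ f x = evalForms (sharpForm Λ φ) (fun i => diff (f i)) x

end Structure

section

variable {E : Type*} [NormedAddCommGroup E] [NormedSpace ℝ E]
  {M : Type*} [TopologicalSpace M] [ChartedSpace E M] [IsManifold 𝓘(ℝ, E) ∞ M]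
  {F : Type*} [NormedField F] [NormedAlgebra ℝ F]

theorem multiVec_add_apply {n : ℕ} (v w : MultiVec E M F n) (x : M)
    (a : Fin n → (TangentSpace 𝓘(ℝ, E) x →L[ℝ] ℝ)) : (v + w).1 x a = v.1 x a + w.1 x a := rfl

theorem multiVec_smul_apply {n : ℕ} (c : F) (v : MultiVec E M F n) (x : M)
    (a : Fin n → (TangentSpace 𝓘(ℝ, E) x →L[ℝ] ℝ)) : (c • v).1 x a = c * v.1 x a := rfl

theorem mvfderiv_multiVec_add {n : ℕ} (v w : MultiVec E M F n) (α : Fin n → OneForm E M) (x : M) :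
    mvfderiv 𝓘(ℝ, E) (fun y => (v + w).1 y (fun l => α l y)) x =
      mvfderiv 𝓘(ℝ, E) (fun y => v.1 y (fun l => α l y)) x +
        mvfderiv 𝓘(ℝ, E) (fun y => w.1 y (fun l => α l y)) x :=
  mvfderiv_add ((v.2 α).mdifferentiableAt (by simp)) ((w.2 α).mdifferentiableAt (by simp))

theorem mvfderiv_multiVec_smul {n : ℕ} (c : F) (v : MultiVec E M F n) (α : Fin n → OneForm E M)
    (x : M) (Z : TangentSpace 𝓘(ℝ, E) x) :
    mvfderiv 𝓘(ℝ, E) (fun y => (c • v).1 y (fun l => α l y)) x Z =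
      c * mvfderiv 𝓘(ℝ, E) (fun y => v.1 y (fun l => α l y)) x Z := by
  have hv : MDifferentiableAt 𝓘(ℝ, E) 𝓘(ℝ, F) (fun y => v.1 y (fun l => α l y)) x :=
    (v.2 α).mdifferentiableAt (by simp)
  have h := ((ContinuousLinearMap.mul ℝ F c).hasMFDerivAt
    (x := v.1 x (fun l => α l x))).comp x hv.hasMFDerivAt
  have h' : mfderiv 𝓘(ℝ, E) 𝓘(ℝ, F) (fun y => (c • v).1 y (fun l => α l y)) x = _ := h.mfderiv
  simp only [mvfderiv, h']
  rfl

end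

section Cohomology

variable {E : Type*} [NormedAddCommGroup E] [NormedSpace ℝ E] [FiniteDimensional ℝ E]
  {M : Type*} [TopologicalSpace M] [ChartedSpace E M] [IsManifold 𝓘(ℝ, E) ∞ M] [T2Space M]
  (A : ATPStructure E M)

/-- The bracket `[α, β]_{φ,θ} = [α, β]_K + i_{Λ^#(β)} i_{Λ^#(α)} φ + Λ(α, β) θ`. -/
def ATPStructure.bracket (α β : OneForm E M) : OneForm E M :=
  koszulBracket A.Λ α β + ((A.φ.interior (sharp A.Λ α)).interior (sharp A.Λ β)).toOneForm +
    fsmul (evalForms A.Λ ![α, β]) A.θ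

variable (F : Type*) [NormedField F] [NormedAlgebra ℝ F]

/-- The operator `∂_{φ,θ}` on `n`-vector fields `v`, where `∂_{φ,θ} v` is given by its values on
1-forms `α₀, …, αₙ`:
`∑_i (-1)^i Λ^#(α_i)(v(…, α̂_i, …)) +
  ∑_{i<j} (-1)^{i+j} v([α_i, α_j]_{φ,θ}, …, α̂_i, …, α̂_j, …)`.
For `F = ℂ` this is the complex linear extension `∂(P₁ + i P₂) = ∂P₁ + i ∂P₂`. -/
def ATPStructure.d : ∀ n : ℕ,
    MultiVec E M F n →ₗ[F] ((Fin (n + 1) → OneForm E M) → M → F)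
  | 0 =>
    { toFun := fun v α x =>
        mvfderiv 𝓘(ℝ, E) (fun y => v.1 y (fun l : Fin 0 => (l.elim0 : OneForm E M) y)) x
          (sharp A.Λ (α 0) x)
      map_add' := by
        intro v w
        ext α x
        have h := mvfderiv_multiVec_add v w (fun l : Fin 0 => l.elim0) x
        exact congrArg (fun L => L (sharp A.Λ (α 0) x)) h
      map_smul' := by
        intro c v
        ext α x
        exact mvfderiv_multiVec_smul c v (fun l : Fin 0 => l.elim0) x (sharp A.Λ (α 0) x) }
  | n + 1 =>
    { toFun := fun v α x =>
        (∑ i : Fin (n + 2), (-1 : F) ^ (i : ℕ) *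
          mvfderiv 𝓘(ℝ, E) (fun y => v.1 y (fun l => α (i.succAbove l) y)) x
            (sharp A.Λ (α i) x)) +
        ∑ j : Fin (n + 2), ∑ i : Fin (n + 1), if i.castSucc < j then
          (-1 : F) ^ ((i : ℕ) + (j : ℕ)) * v.1 x (Matrix.vecCons (A.bracket (α i.castSucc) (α j) x)
            (fun l => α (j.succAbove (i.succAbove l)) x)) else 0
      map_add' := by
        intro v w
        ext α x
        simp only [mvfderiv_multiVec_add]
        simp only [Pi.add_apply, add_apply, mul_add, multiVec_add_apply, Finset.sum_add_distrib,
          ite_add_zero]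
        ring
      map_smul' := by
        intro c v
        ext α x
        simp only [mvfderiv_multiVec_smul]
        simp only [Pi.smul_apply, RingHom.id_apply, smul_eq_mul, multiVec_smul_apply,
          mul_add, Finset.mul_sum, mul_ite, mul_zero, mul_left_comm c] }

/-- An `n`-vector field as a function of `n` smooth 1-forms. This map is injective. -/
def valuesOnForms (n : ℕ) : MultiVec E M F n →ₗ[F] ((Fin n → OneForm E M) → M → F) where
  toFun v α x := v.1 x (fun l => α l x)
  map_add' _ _ := rfl
  map_smul' _ _ := rfl

/-- The cocycles: `n`-vector fields `v` with `∂_{φ,θ} v = 0`. -/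
def ATPStructure.cocycles (n : ℕ) : Submodule F (MultiVec E M F n) := LinearMap.ker (A.d F n)

/-- The coboundaries: `n`-vector fields of the form `∂_{φ,θ} u` for an `(n-1)`-vector field `u`. -/
def ATPStructure.coboundaries : ∀ n : ℕ, Submodule F (MultiVec E M F n)
  | 0 => ⊥
  | n + 1 => (LinearMap.range (A.d F n)).comap (valuesOnForms F (n + 1))

/-- The `θ`-almost twisted Poisson cohomology in degree `n`, cocycles modulo coboundaries:
the real one for `F = ℝ`, the complex one for `F = ℂ`. -/
abbrev ATPStructure.Cohomology (n : ℕ) : Type _ :=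
  A.cocycles F n ⧸ (A.coboundaries F n).submoduleOf (A.cocycles F n)

variable {F} in
/-- The cohomology class of a cocycle. -/
def ATPStructure.cohomologyClass {n : ℕ} (P : A.cocycles F n) : A.Cohomology F n :=
  Submodule.Quotient.mk P

end Cohomology

section LineBundle

variable (E : Type*) [NormedAddCommGroup E] [NormedSpace ℝ E]
  {M : Type*} [TopologicalSpace M] [ChartedSpace E M]
  (K : M → Type*) [TopologicalSpace (Bundle.TotalSpace ℂ K)]
  [∀ x, AddCommGroup (K x)] [∀ x, Module ℂ (K x)] [∀ x, TopologicalSpace (K x)]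
  [FiberBundle ℂ K]

/-- Smooth global sections of a bundle `K` with fibre `ℂ`. -/
abbrev Sections := ContMDiffSection 𝓘(ℝ, E) ℂ ∞ K

variable {E K} in
theorem contMDiff_complex_smul [VectorBundle ℂ ℂ K] (c : ℂ) (s : Sections E K) :
    ContMDiff 𝓘(ℝ, E) (𝓘(ℝ, E).prod 𝓘(ℝ, ℂ)) ∞
      (fun x => Bundle.TotalSpace.mk' ℂ x (c • s x)) := by
  intro x₀
  have hs := s.contMDiff x₀
  rw [Bundle.contMDiffAt_section] at hs ⊢
  have hc : ContDiff ℝ ∞ (fun z : ℂ => c * z) := contDiff_const.mul contDiff_id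
  have h := hc.contMDiff.contMDiffAt.comp x₀ hs
  refine h.congr_of_eventuallyEq ?_
  have hx₀ := FiberBundle.mem_baseSet_trivializationAt' (F := ℂ) (E := K) x₀
  filter_upwards [(trivializationAt ℂ K x₀).open_baseSet.mem_nhds hx₀] with x hx
  exact ((trivializationAt ℂ K x₀).linear ℂ hx).map_smul c (s x)

instance [VectorBundle ℂ ℂ K] : SMul ℂ (Sections E K) :=
  ⟨fun c s => ⟨fun x => c • s x, contMDiff_complex_smul c s⟩⟩

/-- The complex vector space structure on the space of sections of a complex line bundle. -/
instance [VectorBundle ℂ ℂ K] [VectorBundle ℝ ℂ K] : Module ℂ (Sections E K) :=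
  Function.Injective.module ℂ (ContMDiffSection.coeAddHom 𝓘(ℝ, E) ℂ ∞ K)
    ContMDiffSection.coe_injective (fun _ _ => rfl)

variable {E}
variable [FiniteDimensional ℝ E] [IsManifold 𝓘(ℝ, E) ∞ M] [T2Space M]
  [VectorBundle ℂ ℂ K] [VectorBundle ℝ ℂ K]

/-- A contravariant derivative on the complex line bundle `K`: an assignment of a complex linear
endomorphism `D_α` of the space of sections to every 1-form `α`, additive in `α`, with
`D_{fα} = f D_α` and `D_α(fs) = f D_α(s) + Λ^#(α)(f) s`. (Real linearity in `α` is the case of a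
constant `f`.) -/
structure ContravariantDerivative (Λ : MultiVec E M ℝ 2) where
  toFun : OneForm E M → Module.End ℂ (Sections E K)
  map_add : ∀ α β, toFun (α + β) = toFun α + toFun β
  map_fsmul : ∀ (f : SmoothFun E M) (α : OneForm E M) (s : Sections E K),
    toFun (fsmul f α) s = fsmul f (toFun α s)
  leibniz : ∀ (f : SmoothFun E M) (α : OneForm E M) (s : Sections E K),
    toFun α (fsmul f s) = fsmul f (toFun α s) + fsmul (pairing (diff f) (sharp Λ α)) s

variable {K}

/-- The curvature `C_D(α, β) = D_α ∘ D_β - D_β ∘ D_α - D_{[α, β]_{φ,θ}}`. -/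
def curvature (A : ATPStructure E M) (D : ContravariantDerivative K A.Λ) (α β : OneForm E M) :
    Module.End ℂ (Sections E K) :=
  D.toFun α ∘ₗ D.toFun β - D.toFun β ∘ₗ D.toFun α - D.toFun (A.bracket α β)

/-- `P` is the complex bivector field `P_{C_D}` of `D`: `C_D(α, β)(s) = P(α, β) s`. -/
def IsCurvatureBivector (A : ATPStructure E M) (D : ContravariantDerivative K A.Λ)
    (P : MultiVec E M ℂ 2) : Prop :=
  ∀ (α β : OneForm E M) (s : Sections E K) (x : M),
    curvature A D α β s x = P.1 x ![α x, β x] • s x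

variable (E K) in
/-- A smooth Hermitian metric on the complex line bundle `K` (conjugate linear in the first and
linear in the second argument). -/
structure HermitianMetric where
  toFun : ∀ x : M, K x →ₗ⋆[ℂ] K x →ₗ[ℂ] ℂ
  conj_symm : ∀ (x : M) (s t : K x), toFun x t s = starRingEnd ℂ (toFun x s t)
  pos : ∀ (x : M) (s : K x), s ≠ 0 → 0 < (toFun x s s).re
  smooth' : ∀ s t : Sections E K,
    ContMDiff 𝓘(ℝ, E) 𝓘(ℝ, ℂ) ∞ (fun x => toFun x (s x) (t x))

/-- `D` is compatible with `h` if `Λ^#(α)(h(s, t)) = h(D_α s, t) + h(s, D_α t)`. -/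
def IsCompatible {Λ : MultiVec E M ℝ 2} (D : ContravariantDerivative K Λ)
    (h : HermitianMetric E K) : Prop :=
  ∀ (α : OneForm E M) (s t : Sections E K) (x : M),
    mvfderiv 𝓘(ℝ, E) (fun y => h.toFun y (s y) (t y)) x (sharp Λ α x) =
      h.toFun x (D.toFun α s x) (t x) + h.toFun x (s x) (D.toFun α t x)

end LineBundle

/-- A complex multivector field is purely imaginary if all its values are. -/
def IsPurelyImaginary {E : Type*} [NormedAddCommGroup E] [NormedSpace ℝ E]
    {M : Type*} [TopologicalSpace M] [ChartedSpace E M] [IsManifold 𝓘(ℝ, E) ∞ M] {n : ℕ}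
    (P : MultiVec E M ℂ n) : Prop :=
  ∀ (x : M) (a : Fin n → (TangentSpace 𝓘(ℝ, E) x →L[ℝ] ℝ)), (P.1 x a).re = 0

end AlmostTwistedPoisson

end

/-! The bracket $[\cdot,\cdot]_{\varphi,\theta}$ with anchor $\Lambda^\#$ makes $T^*M$ a Lie
algebroid, and the theorem is Chern–Weil theory for a line bundle over it.

The Lie algebroid axioms are where the structure equations enter. On differentials
$[df,dg]=d\{f,g\}+i_{\Lambda^\#dg}i_{\Lambda^\#df}\varphi+\{f,g\}\theta$ with
$\{f,g\}=\Lambda(df,dg)$. The condition $\tfrac12[\Lambda,\Lambda]=\Lambda^\#(\varphi)$ says that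
the cyclic sum of $\{\{f,g\},h\}$ is $\varphi(\Lambda^\#df,\Lambda^\#dg,\Lambda^\#dh)$; with
$\Lambda^\#(\theta)=0$ this makes the anchor a bracket morphism (`ATPStructure.sharp_bracket`). The
Jacobi identity (`ATPStructure.jacobiator_eq_zero`) needs also $d\theta=0$ and
$d\varphi=\theta\wedge\varphi$. In both cases the defect is linear over smooth functions and every
covector is the value of a differential, so differentials suffice.

The anchor property makes $C_D(\alpha,\beta)$ linear over smooth functions, and on a line bundle
such an operator is multiplication by a smooth complex function (`exists_multiplier`). This function
is skew and function-linear in $\alpha,\beta$, hence a bivector field (`exists_multiVec`). The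
Leibniz rule turns $\Lambda^\#(\alpha)(p)$ into the commutator of $D_\alpha$ with multiplication by
$p$. Consequently $\partial P_{C_D}=0$ is the Bianchi identity, that is, the Jacobi identity for
operators and for 1-forms. Two derivatives differ by multiplication with a vector field $V$, and
$C_D-C_{D'}=\partial V$ because multiplications commute. For compatible $D$, the operator $C_D$ is
skew-Hermitian, which forces the multiplier to be imaginary. -/

noncomputable section

namespace AlmostTwistedPoisson

set_option linter.unusedSectionVars false

/-! ### Localization, extension of sections and tensoriality. -/

section Tensoriality

open Bundle

variable {E : Type*} [NormedAddCommGroup E] [NormedSpace ℝ E] [FiniteDimensional ℝ E]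
  {M : Type*} [TopologicalSpace M] [ChartedSpace E M] [IsManifold 𝓘(ℝ, E) ∞ M]
  {F : Type*} [NormedAddCommGroup F] [NormedSpace ℝ F]
  {V : M → Type*} [TopologicalSpace (TotalSpace F V)] [∀ x, TopologicalSpace (V x)]
  [FiberBundle F V] [∀ x, AddCommGroup (V x)] [∀ x, Module ℝ (V x)] [VectorBundle ℝ F V]

@[simp]
theorem fsmul_apply (f : SmoothFun E M) (s : ContMDiffSection 𝓘(ℝ, E) F ∞ V) (x : M) :
    fsmul f s x = f x • s x := rfl

theorem mul_apply (f g : SmoothFun E M) (x : M) : (f * g) x = f x * g x := rfl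

theorem sum_apply {ι : Type*} (t : Finset ι) (s : ι → ContMDiffSection 𝓘(ℝ, E) F ∞ V) (x : M) :
    (∑ i ∈ t, s i) x = ∑ i ∈ t, s i x := by
  classical
  induction t using Finset.induction_on with
  | empty => rfl
  | insert a t ha h => rw [Finset.sum_insert ha, Finset.sum_insert ha, ← h]; rfl

/-- A bump function at `x` supported in a given neighbourhood. -/
theorem exists_bump [T2Space M] {x : M} {U : Set M} (hU : U ∈ nhds x) :
    ∃ ψ : SmoothFun E M, (ψ : M → ℝ) =ᶠ[nhds x] 1 ∧ tsupport ψ ⊆ U := by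
  obtain ⟨ψ, hψ, -⟩ := (SmoothBumpFunction.nhds_basis_support (I := 𝓘(ℝ, E)) hU).mem_iff.mp hU
  exact ⟨⟨ψ, ψ.contMDiff⟩, ψ.eventuallyEq_one, hψ⟩

variable [T2Space M]

/-- A section that is smooth on a neighbourhood of `x` agrees near `x` with a global section. -/
theorem exists_section_eventuallyEq {x : M} {U : Set M} (hU : IsOpen U) (hx : x ∈ U)
    {s : ∀ y : M, V y}
    (hs : ContMDiffOn 𝓘(ℝ, E) (𝓘(ℝ, E).prod 𝓘(ℝ, F)) ∞ (fun y => TotalSpace.mk' F y (s y)) U) :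
    ∃ t : ContMDiffSection 𝓘(ℝ, E) F ∞ V, ∀ᶠ y in nhds x, t y = s y := by
  obtain ⟨ψ, hψ, hψU⟩ := exists_bump (E := E) (hU.mem_nhds hx)
  refine ⟨⟨_, ContMDiffOn.smul_section_of_tsupport (ψ.contMDiff.contMDiffOn) hU hψU hs⟩, ?_⟩
  filter_upwards [hψ] with y hy
  change ψ y • s y = s y
  simp [hy]

/-- A function that is smooth on a neighbourhood of `x` agrees near `x` with a global one. -/
theorem exists_smoothFun_eventuallyEq {x : M} {U : Set M} (hU : IsOpen U) (hx : x ∈ U)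
    {f : M → ℝ} (hf : ContMDiffOn 𝓘(ℝ, E) 𝓘(ℝ, ℝ) ∞ f U) :
    ∃ g : SmoothFun E M, ∀ᶠ y in nhds x, g y = f y := by
  have hf' : ContMDiffOn 𝓘(ℝ, E) (𝓘(ℝ, E).prod 𝓘(ℝ, ℝ)) ∞
      (fun y => TotalSpace.mk' ℝ (E := Bundle.Trivial M ℝ) y (f y)) U := by
    intro y hy
    exact Bundle.contMDiffWithinAt_section.mpr (hf y hy)
  obtain ⟨t, ht⟩ := exists_section_eventuallyEq hU hx hf'
  refine ⟨⟨fun y => t y, fun y => (Bundle.contMDiffAt_section y).mp (t.contMDiff y)⟩, ht⟩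

variable [FiniteDimensional ℝ F] [ContMDiffVectorBundle ∞ F V 𝓘(ℝ, E)]

/-- Near every point, every section is a combination of finitely many global sections with
coefficients given by global smooth functions that vanish wherever the section does. -/
theorem exists_frame_expansion (x : M) (s : ContMDiffSection 𝓘(ℝ, E) F ∞ V) :
    ∃ (t : Fin (Module.finrank ℝ F) → ContMDiffSection 𝓘(ℝ, E) F ∞ V)
      (c : Fin (Module.finrank ℝ F) → SmoothFun E M),
      (∀ᶠ y in nhds x, s y = ∑ i, c i y • t i y) ∧ (s x = 0 → ∀ i, c i x = 0) := by
  have : ContMDiffVectorBundle 1 F V 𝓘(ℝ, E) := ContMDiffVectorBundle.of_le (n := ∞) (by simp)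
  set e := trivializationAt F V x with he
  have hx : x ∈ e.baseSet := FiberBundle.mem_baseSet_trivializationAt' x
  let b := Module.finBasis ℝ F
  choose t ht using fun i => exists_section_eventuallyEq (E := E) e.open_baseSet hx
    (e.contMDiffOn_localFrame_baseSet ∞ b i)
  choose c hc using fun i => exists_smoothFun_eventuallyEq (E := E) e.open_baseSet hx
    (contMDiffOn_baseSet_localFrameCoeff (I := 𝓘(ℝ, E)) b (e := e)
      (s.contMDiff.contMDiffOn) i)
  refine ⟨t, c, ?_, fun h i => ?_⟩
  · filter_upwards [Filter.eventually_all.mpr ht, Filter.eventually_all.mpr hc,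
      e.eventually_eq_localFrame_sum_coeff_smul (I := 𝓘(ℝ, E)) (s := s) b hx] with y h1 h2 h3
    rw [h3]
    refine Finset.sum_congr rfl fun i _ => ?_
    rw [h1, h2]
    rfl
  · rw [(hc i).self_of_nhds]
    simp [h]

variable {N : Type*} [AddCommGroup N] [Module ℝ N]

/-- An additive map on sections which is linear over smooth functions at `x` only depends on the
value of the section at `x`. -/
theorem tensorial_eq_zero {x : M} {T : ContMDiffSection 𝓘(ℝ, E) F ∞ V → N}
    (hadd : ∀ s t, T (s + t) = T s + T t)
    (hsmul : ∀ (f : SmoothFun E M) s, T (fsmul f s) = f x • T s)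
    {s : ContMDiffSection 𝓘(ℝ, E) F ∞ V} (hs : s x = 0) : T s = 0 := by
  obtain ⟨t, c, h1, h2⟩ := exists_frame_expansion x s
  obtain ⟨U, hU, hUo, hxU⟩ := eventually_nhds_iff.mp h1
  obtain ⟨ψ, hψ, hψU⟩ := exists_bump (E := E) (hUo.mem_nhds hxU)
  have hψx : ψ x = 1 := hψ.self_of_nhds
  let T' : ContMDiffSection 𝓘(ℝ, E) F ∞ V →+ N := AddMonoidHom.mk' T hadd
  -- The frame expansion holds only on `U`; cutting off by `ψ` makes it a global identity to which
  -- additivity of `T` applies.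
  have key : fsmul ψ s = ∑ i, fsmul (ψ * c i) (t i) := by
    ext y
    rw [sum_apply]
    simp only [fsmul_apply, mul_apply, mul_smul, ← Finset.smul_sum]
    by_cases hy : y ∈ U
    · rw [hU y hy]
    · rw [image_eq_zero_of_notMem_tsupport (fun h => hy (hψU h)), zero_smul, zero_smul]
  have h3 : T (fsmul ψ s) = T s := by rw [hsmul, hψx, one_smul]
  rw [← h3, key]
  change T' _ = 0
  rw [map_sum]
  refine Finset.sum_eq_zero fun i _ => ?_
  change T _ = 0
  rw [hsmul, mul_apply, h2 hs i, mul_zero, zero_smul]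

theorem tensorial_congr {x : M} {T : ContMDiffSection 𝓘(ℝ, E) F ∞ V → N}
    (hadd : ∀ s t, T (s + t) = T s + T t)
    (hsmul : ∀ (f : SmoothFun E M) s, T (fsmul f s) = f x • T s)
    {s t : ContMDiffSection 𝓘(ℝ, E) F ∞ V} (h : s x = t x) : T s = T t := by
  have h1 := tensorial_eq_zero hadd hsmul (s := s - t) (by simp [h])
  have h2 := hadd (s - t) t
  rwa [sub_add_cancel, h1, zero_add] at h2

/-- Every vector of a fibre extends to a global section. -/
theorem exists_section_apply_eq {x : M} (v : V x) :
    ∃ s : ContMDiffSection 𝓘(ℝ, E) F ∞ V, s x = v := by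
  set e := trivializationAt F V x with he
  have hx : x ∈ e.baseSet := FiberBundle.mem_baseSet_trivializationAt' x
  have h : ContMDiffOn 𝓘(ℝ, E) (𝓘(ℝ, E).prod 𝓘(ℝ, F)) ∞
      (fun y => TotalSpace.mk' F y (e.symm y (e ⟨x, v⟩).2)) e.baseSet := by
    rw [e.contMDiffOn_section_baseSet_iff]
    refine (contMDiffOn_const (c := (e ⟨x, v⟩).2)).congr fun y hy => ?_
    simp [e.apply_mk_symm hy]
  obtain ⟨t, ht⟩ := exists_section_eventuallyEq e.open_baseSet hx h
  refine ⟨t, ht.self_of_nhds.trans ?_⟩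
  exact e.symm_apply_apply_mk hx v

theorem exists_section_vector {x : M} (v : TangentSpace 𝓘(ℝ, E) x) : ∃ X : VField E M, X x = v :=
  exists_section_apply_eq v

theorem exists_section_covector {x : M} (v : TangentSpace 𝓘(ℝ, E) x →L[ℝ] ℝ) :
    ∃ a : OneForm E M, a x = v :=
  exists_section_apply_eq (V := fun x : M => TangentSpace 𝓘(ℝ, E) x →L[ℝ] ℝ) v

/-- Every covector is the differential of a global smooth function. -/
theorem exists_diff_apply_eq {x : M} (v : TangentSpace 𝓘(ℝ, E) x →L[ℝ] ℝ) :
    ∃ f : SmoothFun E M, diff f x = v := by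
  obtain ⟨B, hB⟩ := isInvertible_mfderiv_extChartAt (I := 𝓘(ℝ, E))
    (mem_extChartAt_source (I := 𝓘(ℝ, E)) x)
  -- `B` is the derivative of the chart at `x`, so the function `L` ∘ chart has differential `v` at
  -- `x`.
  let L : E →L[ℝ] ℝ := v.comp
    (B.symm : TangentSpace 𝓘(ℝ, E) (extChartAt 𝓘(ℝ, E) x x) →L[ℝ] TangentSpace 𝓘(ℝ, E) x)
  have hf : ContMDiffOn 𝓘(ℝ, E) 𝓘(ℝ, ℝ) ∞ (fun y => L (extChartAt 𝓘(ℝ, E) x y))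
      (chartAt E x).source :=
    L.contDiff.contMDiff.comp_contMDiffOn contMDiffOn_extChartAt
  obtain ⟨g, hg⟩ := exists_smoothFun_eventuallyEq (E := E) (chartAt E x).open_source
    (mem_chart_source E x) hf
  refine ⟨g, ?_⟩
  have h1 : MDifferentiableAt 𝓘(ℝ, E) 𝓘(ℝ, E) (extChartAt 𝓘(ℝ, E) x) x :=
    mdifferentiableAt_extChartAt (mem_chart_source E x)
  have h2 := (L.hasMFDerivAt (x := extChartAt 𝓘(ℝ, E) x x)).comp x h1.hasMFDerivAt
  have h3 : mfderiv 𝓘(ℝ, E) 𝓘(ℝ, ℝ) g x = _ := (h2.congr_of_eventuallyEq hg).mfderiv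
  change mvfderiv 𝓘(ℝ, E) g x = v
  rw [← hB] at h3
  ext w
  have h4 := congrArg (fun A => A w) h3
  refine h4.trans ?_
  change v (B.symm (B w)) = v w
  rw [B.symm_apply_apply]

end Tensoriality

/-! ### Cartan calculus of functions, 1-forms and vector fields. -/

section VectorCalculus

variable {E : Type*} [NormedAddCommGroup E] [NormedSpace ℝ E] [FiniteDimensional ℝ E]
  {M : Type*} [TopologicalSpace M] [ChartedSpace E M] [IsManifold 𝓘(ℝ, E) ∞ M]

/-- The derivative `X(f)` of a smooth function along a vector field. -/
def act (X : VField E M) (f : SmoothFun E M) : SmoothFun E M := pairing (diff f) X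

theorem act_apply (X : VField E M) (f : SmoothFun E M) (x : M) :
    act X f x = mvfderiv 𝓘(ℝ, E) f x (X x) := rfl

theorem pairing_apply (a : OneForm E M) (X : VField E M) (x : M) : pairing a X x = a x (X x) := rfl

theorem pairing_diff (X : VField E M) (f : SmoothFun E M) : pairing (diff f) X = act X f := rfl

theorem SmoothFun.mdifferentiableAt (f : SmoothFun E M) (x : M) :
    MDifferentiableAt 𝓘(ℝ, E) 𝓘(ℝ, ℝ) f x := f.contMDiff.mdifferentiableAt (by simp)

theorem diff_add (f g : SmoothFun E M) : diff (f + g) = diff f + diff g := by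
  ext1 x
  exact mvfderiv_add (f.mdifferentiableAt x) (g.mdifferentiableAt x)

theorem diff_mul (f g : SmoothFun E M) : diff (f * g) = fsmul f (diff g) + fsmul g (diff f) := by
  ext1 x
  exact mvfderiv_mul (f.mdifferentiableAt x) (g.mdifferentiableAt x)

theorem pairing_add_left (a b : OneForm E M) (X : VField E M) :
    pairing (a + b) X = pairing a X + pairing b X := rfl

theorem pairing_sub_left (a b : OneForm E M) (X : VField E M) :
    pairing (a - b) X = pairing a X - pairing b X := rfl

theorem pairing_fsmul_left (f : SmoothFun E M) (a : OneForm E M) (X : VField E M) :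
    pairing (fsmul f a) X = f * pairing a X := rfl

theorem pairing_add_right (a : OneForm E M) (X Y : VField E M) :
    pairing a (X + Y) = pairing a X + pairing a Y := by
  ext x; exact map_add (a x) _ _

theorem pairing_sub_right (a : OneForm E M) (X Y : VField E M) :
    pairing a (X - Y) = pairing a X - pairing a Y := by
  ext x; exact map_sub (a x) _ _

theorem pairing_fsmul_right (f : SmoothFun E M) (a : OneForm E M) (X : VField E M) :
    pairing a (fsmul f X) = f * pairing a X := by
  ext x; exact map_smul (a x) _ _

theorem act_add (X : VField E M) (f g : SmoothFun E M) : act X (f + g) = act X f + act X g := by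
  rw [act, diff_add]; rfl

theorem act_zero (X : VField E M) : act X (0 : SmoothFun E M) = 0 := by
  have h := act_add X 0 0
  rw [add_zero] at h
  exact left_eq_add.mp h

theorem act_neg (X : VField E M) (f : SmoothFun E M) : act X (-f) = -act X f := by
  have h := act_add X f (-f)
  rw [add_neg_cancel, act_zero] at h
  exact (neg_eq_of_add_eq_zero_right h.symm).symm

theorem act_mul (X : VField E M) (f g : SmoothFun E M) :
    act X (f * g) = f * act X g + g * act X f := by
  rw [act, diff_mul]; rfl

theorem lieBracket_swap (X Y : VField E M) : lieBracket Y X = -lieBracket X Y := by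
  ext1 x
  exact VectorField.mlieBracket_swap_apply

theorem lieBracket_add_right (X Y Z : VField E M) :
    lieBracket X (Y + Z) = lieBracket X Y + lieBracket X Z := by
  ext1 x
  exact VectorField.mlieBracket_add_right Y.mdifferentiableAt Z.mdifferentiableAt

theorem lieBracket_add_left (X Y Z : VField E M) :
    lieBracket (X + Y) Z = lieBracket X Z + lieBracket Y Z := by
  ext1 x
  exact VectorField.mlieBracket_add_left X.mdifferentiableAt Y.mdifferentiableAt

theorem lieBracket_fsmul_right (f : SmoothFun E M) (X Y : VField E M) :
    lieBracket X (fsmul f Y) = fsmul (act X f) Y + fsmul f (lieBracket X Y) := by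
  ext1 x
  exact VectorField.mlieBracket_smul_right (f.mdifferentiableAt x) Y.mdifferentiableAt

theorem lieBracket_fsmul_left (f : SmoothFun E M) (X Y : VField E M) :
    lieBracket (fsmul f X) Y = fsmul f (lieBracket X Y) - fsmul (act Y f) X := by
  rw [lieBracket_swap, lieBracket_fsmul_right, lieBracket_swap X Y]
  ext1 x
  change -(act Y f x • X x + f x • -lieBracket X Y x) = f x • lieBracket X Y x - act Y f x • X x
  rw [smul_neg]
  abel

theorem lieBracket_jacobi (X Y Z : VField E M) :
    lieBracket X (lieBracket Y Z) =
      lieBracket (lieBracket X Y) Z + lieBracket Y (lieBracket X Z) := by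
  have h1 : IsManifold 𝓘(ℝ, E) (minSmoothness ℝ 3) M :=
    IsManifold.of_le (n := ∞) (by simpa using! (ENat.LEInfty.out : (3 : ℕ∞ω) ≤ ∞))
  have h2 (W : VField E M) : ContMDiff 𝓘(ℝ, E) (𝓘(ℝ, E).prod 𝓘(ℝ, E)) (minSmoothness ℝ 2)
      (fun x => Bundle.TotalSpace.mk' E (E := fun x : M => TangentSpace 𝓘(ℝ, E) x) x (W x)) :=
    W.contMDiff.of_le (by simpa using! (ENat.LEInfty.out : (2 : ℕ∞ω) ≤ ∞))
  ext1 x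
  exact VectorField.leibniz_identity_mlieBracket_apply (h2 X x) (h2 Y x) (h2 Z x)

variable [T2Space M]

theorem VField.ext_pairing {X Y : VField E M} (h : ∀ a : OneForm E M, pairing a X = pairing a Y) :
    X = Y := by
  ext1 x
  rw [← sub_eq_zero]
  by_contra hne
  obtain ⟨v, hv⟩ := SeparatingDual.exists_ne_zero (R := ℝ) (V := E) hne
  obtain ⟨a, ha⟩ := exists_section_covector (x := x) v
  apply hv
  have := congrArg (fun f : SmoothFun E M => f x) (h a)
  simp only [pairing_apply, ha] at this
  exact (map_sub v (X x) (Y x)).trans (sub_eq_zero.mpr this)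

theorem VField.ext_act {X Y : VField E M} (h : ∀ f : SmoothFun E M, act X f = act Y f) :
    X = Y := by
  refine VField.ext_pairing fun a => ?_
  ext x
  obtain ⟨f, hf⟩ := exists_diff_apply_eq (a x)
  have := congrArg (fun f : SmoothFun E M => f x) (h f)
  rw [pairing_apply, pairing_apply, ← hf]
  exact this

theorem OneForm.ext_pairing {a b : OneForm E M} (h : ∀ X : VField E M, pairing a X = pairing b X) :
    a = b := by
  ext1 x
  ext v
  obtain ⟨X, rfl⟩ := exists_section_vector v
  exact congrArg (fun f : SmoothFun E M => f x) (h X)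

/-- Obtained from the Jacobi identity without charts: expand it for $X,Y,fW$ by the Leibniz rule.
The first-order terms in $f$ with bracketed $W$ cancel, the undifferentiated ones form the Jacobi
identity for $X,Y,W$, and what remains is the claim multiplied by $W$. -/
theorem act_lieBracket (X Y : VField E M) (f : SmoothFun E M) :
    act (lieBracket X Y) f = act X (act Y f) - act Y (act X f) := by
  have key (W : VField E M) :
      fsmul (act (lieBracket X Y) f) W = fsmul (act X (act Y f) - act Y (act X f)) W := by
    have h1 := lieBracket_jacobi X Y (fsmul f W)
    have h2 := lieBracket_jacobi X Y W
    simp only [lieBracket_fsmul_right, lieBracket_add_right, h2] at h1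
    ext1 x
    have h3 := congrArg (fun Z : VField E M => Z x) h1
    simp only [ContMDiffSection.coe_add, Pi.add_apply, fsmul_apply, smul_add] at h3
    rw [fsmul_apply, fsmul_apply]
    change _ = (act X (act Y f) x - act Y (act X f) x) • W x
    rw [sub_smul, eq_sub_iff_add_eq, ← sub_eq_zero]
    rw [← sub_eq_zero] at h3
    rw [← neg_eq_zero, ← h3]
    abel
  ext x
  -- The factor $W$ can be cancelled at `x` unless the tangent space is zero, and then all
  -- derivatives vanish.
  by_cases hE : ∃ v : TangentSpace 𝓘(ℝ, E) x, v ≠ 0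
  · obtain ⟨v, hv⟩ := hE
    obtain ⟨W, rfl⟩ := exists_section_vector v
    exact smul_left_injective ℝ hv (congrArg (fun Z : VField E M => Z x) (key W))
  · push Not at hE
    have h0 (Z : VField E M) (g : SmoothFun E M) : act Z g x = 0 := by
      rw [act_apply, hE (Z x)]
      exact map_zero _
    change _ = act X (act Y f) x - act Y (act X f) x
    simp only [h0, sub_zero]

theorem pairing_lieDeriv (X Z : VField E M) (β : OneForm E M) :
    pairing (lieDeriv X β) Z = act X (pairing β Z) - pairing β (lieBracket X Z) := by
  ext x
  exact mkHom_lieDerivAux X β Z x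

end VectorCalculus

/-! ### The bracket of 1-forms, and the Schouten condition on functions. -/

section Brackets

variable {E : Type*} [NormedAddCommGroup E] [NormedSpace ℝ E] [FiniteDimensional ℝ E]
  {M : Type*} [TopologicalSpace M] [ChartedSpace E M] [IsManifold 𝓘(ℝ, E) ∞ M]

/-- The smooth function `φ(X, Y, Z)`. -/
def KForm.eval₃ [T2Space M] (φ : KForm E M 3) (X Y Z : VField E M) : SmoothFun E M :=
  ⟨fun x => φ x ![X x, Y x, Z x], (φ.smooth' ![X, Y, Z]).congr fun x => by
    congr 1
    ext i
    fin_cases i <;> rfl⟩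

variable [T2Space M]

theorem evalForms_pair (Λ : MultiVec E M ℝ 2) (α β : OneForm E M) :
    evalForms Λ ![α, β] = pairing β (sharp Λ α) := by
  ext x
  refine Eq.trans ?_ (apply_sharpAt Λ x (α x) (β x)).symm
  change Λ.1 x _ = _
  congr 1
  ext i
  fin_cases i <;> rfl

theorem pairing_sharp_swap (Λ : MultiVec E M ℝ 2) (α β : OneForm E M) :
    pairing β (sharp Λ α) = -pairing α (sharp Λ β) := by
  ext x
  refine (apply_sharpAt Λ x (α x) (β x)).trans ?_
  refine Eq.trans ?_ (congrArg Neg.neg (apply_sharpAt Λ x (β x) (α x))).symm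
  have h := (Λ.1 x).map_swap ![β x, α x] (i := 0) (j := 1) (by decide)
  rw [← h]
  congr 1
  ext i
  fin_cases i <;> rfl

theorem sharp_add (Λ : MultiVec E M ℝ 2) (α β : OneForm E M) :
    sharp Λ (α + β) = sharp Λ α + sharp Λ β := by
  ext1 x
  exact map_add (sharpAt Λ x) _ _

theorem sharp_fsmul (Λ : MultiVec E M ℝ 2) (f : SmoothFun E M) (α : OneForm E M) :
    sharp Λ (fsmul f α) = fsmul f (sharp Λ α) := by
  ext1 x
  exact map_smul (sharpAt Λ x) _ _

theorem sharp_neg (Λ : MultiVec E M ℝ 2) (α : OneForm E M) :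
    sharp Λ (-α) = -sharp Λ α := by
  ext1 x
  exact map_neg (sharpAt Λ x) _

variable (φ : KForm E M 3)

theorem KForm.eval₃_add_left (X X' Y Z : VField E M) :
    φ.eval₃ (X + X') Y Z = φ.eval₃ X Y Z + φ.eval₃ X' Y Z := by
  ext x
  exact (φ x).map_vecCons_add ![Y x, Z x] (X x) (X' x)

theorem KForm.eval₃_fsmul_left (f : SmoothFun E M) (X Y Z : VField E M) :
    φ.eval₃ (fsmul f X) Y Z = f * φ.eval₃ X Y Z := by
  ext x
  exact (φ x).map_vecCons_smul ![Y x, Z x] (f x) (X x)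

theorem KForm.eval₃_swap (X Y Z : VField E M) : φ.eval₃ X Y Z = -φ.eval₃ Y X Z := by
  ext x
  have h := (φ x).map_swap ![Y x, X x, Z x] (i := 0) (j := 1) (by decide)
  refine Eq.trans ?_ h
  change (φ x) _ = _
  congr 1
  ext i
  fin_cases i <;> rfl

theorem KForm.eval₃_swap_right (X Y Z : VField E M) : φ.eval₃ X Y Z = -φ.eval₃ X Z Y := by
  ext x
  have h := (φ x).map_swap ![X x, Z x, Y x] (i := 1) (j := 2) (by decide)
  refine Eq.trans ?_ h
  change (φ x) _ = _
  congr 1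
  ext i
  fin_cases i <;> rfl

theorem KForm.eval₃_rotate (X Y Z : VField E M) : φ.eval₃ X Y Z = φ.eval₃ Y Z X := by
  rw [φ.eval₃_swap, φ.eval₃_swap_right, neg_neg]

theorem pairing_interior_interior (X Y Z : VField E M) :
    pairing ((φ.interior X).interior Y).toOneForm Z = φ.eval₃ X Y Z := by
  ext x
  change (φ x) _ = (φ x) _
  congr 1
  ext i
  fin_cases i <;> rfl

theorem KForm.apply_eq_eval₃ {x : M} {v : Fin 3 → TangentSpace 𝓘(ℝ, E) x} (X Y Z : VField E M)
    (h0 : v 0 = X x) (h1 : v 1 = Y x) (h2 : v 2 = Z x) : φ x v = φ.eval₃ X Y Z x := by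
  refine congrArg (φ x) ?_
  ext i
  fin_cases i <;> assumption

theorem KForm.mvfderiv_apply_eq_act {v : ∀ x : M, Fin 3 → TangentSpace 𝓘(ℝ, E) x}
    (X Y Z W : VField E M) (h0 : ∀ x, v x 0 = X x) (h1 : ∀ x, v x 1 = Y x)
    (h2 : ∀ x, v x 2 = Z x) (x : M) :
    mvfderiv 𝓘(ℝ, E) (fun y => φ y (v y)) x (W x) = act W (φ.eval₃ X Y Z) x := by
  rw [funext fun y => φ.apply_eq_eval₃ X Y Z (h0 y) (h1 y) (h2 y)]
  rfl

/-- The exterior derivative of a 3-form. -/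
theorem KForm.extDeriv_three (X Y Z W : VField E M) (x : M) :
    φ.extDeriv ![X, Y, Z, W] x =
      (act X (φ.eval₃ Y Z W) - act Y (φ.eval₃ X Z W) + act Z (φ.eval₃ X Y W) -
        act W (φ.eval₃ X Y Z) - φ.eval₃ (lieBracket X Y) Z W + φ.eval₃ (lieBracket X Z) Y W -
        φ.eval₃ (lieBracket X W) Y Z - φ.eval₃ (lieBracket Y Z) X W +
        φ.eval₃ (lieBracket Y W) X Z - φ.eval₃ (lieBracket Z W) X Y) x := by
  rw [KForm.extDeriv]
  rw [Fin.sum_univ_four, Fin.sum_univ_four, Fin.sum_univ_three, Fin.sum_univ_three,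
    Fin.sum_univ_three, Fin.sum_univ_three,
    φ.mvfderiv_apply_eq_act Y Z W (![X, Y, Z, W] 0) (fun _ => rfl) (fun _ => rfl) (fun _ => rfl),
    φ.mvfderiv_apply_eq_act X Z W (![X, Y, Z, W] 1) (fun _ => rfl) (fun _ => rfl) (fun _ => rfl),
    φ.mvfderiv_apply_eq_act X Y W (![X, Y, Z, W] 2) (fun _ => rfl) (fun _ => rfl) (fun _ => rfl),
    φ.mvfderiv_apply_eq_act X Y Z (![X, Y, Z, W] 3) (fun _ => rfl) (fun _ => rfl) (fun _ => rfl)]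
  rw [if_neg (by decide), if_neg (by decide), if_neg (by decide), if_pos (by decide),
    if_neg (by decide), if_neg (by decide), if_pos (by decide), if_pos (by decide),
    if_neg (by decide), if_pos (by decide), if_pos (by decide), if_pos (by decide)]
  rw [φ.apply_eq_eval₃ (lieBracket X Y) Z W rfl rfl rfl,
    φ.apply_eq_eval₃ (lieBracket X Z) Y W rfl rfl rfl,
    φ.apply_eq_eval₃ (lieBracket Y Z) X W rfl rfl rfl,
    φ.apply_eq_eval₃ (lieBracket X W) Y Z rfl rfl rfl,
    φ.apply_eq_eval₃ (lieBracket Y W) X Z rfl rfl rfl,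
    φ.apply_eq_eval₃ (lieBracket Z W) X Y rfl rfl rfl]
  change _ = act X (φ.eval₃ Y Z W) x - act Y (φ.eval₃ X Z W) x + act Z (φ.eval₃ X Y W) x -
        act W (φ.eval₃ X Y Z) x - φ.eval₃ (lieBracket X Y) Z W x + φ.eval₃ (lieBracket X Z) Y W x -
        φ.eval₃ (lieBracket X W) Y Z x - φ.eval₃ (lieBracket Y Z) X W x +
        φ.eval₃ (lieBracket Y W) X Z x - φ.eval₃ (lieBracket Z W) X Y x
  simp [pow_succ]
  ring

theorem KForm.oneWedge_three (θ : OneForm E M) (X Y Z W : VField E M) (x : M) :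
    KForm.oneWedge θ φ ![X, Y, Z, W] x =
      (pairing θ X * φ.eval₃ Y Z W - pairing θ Y * φ.eval₃ X Z W + pairing θ Z * φ.eval₃ X Y W -
        pairing θ W * φ.eval₃ X Y Z) x := by
  rw [KForm.oneWedge, Fin.sum_univ_four, φ.apply_eq_eval₃ Y Z W rfl rfl rfl,
    φ.apply_eq_eval₃ X Z W rfl rfl rfl, φ.apply_eq_eval₃ X Y W rfl rfl rfl,
    φ.apply_eq_eval₃ X Y Z rfl rfl rfl]
  change _ = θ x (X x) * φ.eval₃ Y Z W x - θ x (Y x) * φ.eval₃ X Z W x +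
    θ x (Z x) * φ.eval₃ X Y W x - θ x (W x) * φ.eval₃ X Y Z x
  simp [pow_succ]
  ring

theorem sum_perm_fin_three {R : Type*} [AddCommMonoid R] (F : Equiv.Perm (Fin 3) → R) :
    ∑ σ, F σ = F 1 + F (Equiv.swap 0 1) + F (Equiv.swap 0 2) + F (Equiv.swap 1 2) +
      F (Equiv.swap 0 1 * Equiv.swap 1 2) + F (Equiv.swap 1 2 * Equiv.swap 0 1) := by
  have h : (Finset.univ : Finset (Equiv.Perm (Fin 3))) = {1, Equiv.swap 0 1, Equiv.swap 0 2,
    Equiv.swap 1 2, Equiv.swap 0 1 * Equiv.swap 1 2, Equiv.swap 1 2 * Equiv.swap 0 1} := by decide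
  rw [h]
  rw [Finset.sum_insert (by decide), Finset.sum_insert (by decide), Finset.sum_insert (by decide),
    Finset.sum_insert (by decide), Finset.sum_insert (by decide), Finset.sum_singleton]
  abel

theorem evalForms_eq_act (Λ : MultiVec E M ℝ 2) {α : Fin 2 → OneForm E M} (f g : SmoothFun E M)
    (h0 : α 0 = diff f) (h1 : α 1 = diff g) : evalForms Λ α = act (sharp Λ (diff f)) g := by
  rw [act, ← evalForms_pair]
  congr 1
  ext1 i
  fin_cases i <;> assumption

/-- Skew-symmetry of $\Lambda$ makes each of the three cyclic terms appear twice among the six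
permutations, which cancels the factor $1/(2!\,1!)$. -/
theorem insertion_self (Λ : MultiVec E M ℝ 2) (f g h : SmoothFun E M) (x : M) :
    insertion (N := 3) rfl Λ Λ ![f, g, h] x =
      (act (sharp Λ (diff (act (sharp Λ (diff f)) g))) h +
        act (sharp Λ (diff (act (sharp Λ (diff g)) h))) f +
        act (sharp Λ (diff (act (sharp Λ (diff h)) f))) g) x := by
  have hs (u v : SmoothFun E M) : act (sharp Λ (diff u)) v = -act (sharp Λ (diff v)) u :=
    pairing_sharp_swap Λ (diff u) (diff v)
  have hn (u v w : SmoothFun E M) : act (sharp Λ (diff (act (sharp Λ (diff u)) v))) w =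
      -act (sharp Λ (diff (act (sharp Λ (diff v)) u))) w := by
    rw [hs u v, hs, act_neg, hs w, neg_neg]
  have key (σ : Equiv.Perm (Fin 3)) (u v w : SmoothFun E M) (hu : ![f, g, h] (σ 0) = u)
      (hv : ![f, g, h] (σ 1) = v) (hw : ![f, g, h] (σ 2) = w) :
      evalForms Λ (Matrix.vecCons
        (diff (evalForms Λ fun i => diff (![f, g, h] (σ ((i.castAdd 1).cast rfl)))))
        (fun i => diff (![f, g, h] (σ ((i.natAdd (1 + 1)).cast rfl))))) =
      act (sharp Λ (diff (act (sharp Λ (diff u)) v))) w := by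
    refine (evalForms_eq_act Λ _ w rfl (congrArg diff hw)).trans ?_
    rw [evalForms_eq_act Λ u v (congrArg diff hu) (congrArg diff hv)]
  rw [insertion, sum_perm_fin_three, key 1 f g h rfl rfl rfl,
    key (Equiv.swap 0 1) g f h rfl rfl rfl,
    key (Equiv.swap 0 2) h g f rfl rfl rfl, key (Equiv.swap 1 2) f h g rfl rfl rfl,
    key (Equiv.swap 0 1 * Equiv.swap 1 2) g h f rfl rfl rfl,
    key (Equiv.swap 1 2 * Equiv.swap 0 1) h f g rfl rfl rfl, hn g f, hn h g, hn f h]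
  simp only [Equiv.Perm.sign_one, Equiv.Perm.sign_mul,
    Equiv.Perm.sign_swap (show (0 : Fin 3) ≠ 1 by decide),
    Equiv.Perm.sign_swap (show (0 : Fin 3) ≠ 2 by decide),
    Equiv.Perm.sign_swap (show (1 : Fin 3) ≠ 2 by decide)]
  simp
  ring

/-- For two bivector fields the sign $(-1)^{pq}$ is $-1$, so the two insertions add up instead of
cancelling. -/
theorem schouten_self (Λ : MultiVec E M ℝ 2) (f g h : SmoothFun E M) (x : M) :
    (1 / 2 : ℝ) * schouten Λ Λ ![f, g, h] x =
      -(act (sharp Λ (diff (act (sharp Λ (diff f)) g))) h +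
        act (sharp Λ (diff (act (sharp Λ (diff g)) h))) f +
        act (sharp Λ (diff (act (sharp Λ (diff h)) f))) g) x := by
  rw [schouten, insertion_self]
  ring

theorem evalForms_sharpForm (Λ : MultiVec E M ℝ 2) (f g h : SmoothFun E M) (x : M) :
    evalForms (sharpForm Λ φ) (fun i => diff (![f, g, h] i)) x =
      -φ.eval₃ (sharp Λ (diff f)) (sharp Λ (diff g)) (sharp Λ (diff h)) x := by
  change (-1 : ℝ) ^ 3 * (φ x) _ = -(φ x) _
  rw [show (-1 : ℝ) ^ 3 = -1 by norm_num, neg_one_mul]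
  congr 2
  ext i
  fin_cases i <;> rfl

variable (A : ATPStructure E M)

theorem ATPStructure.pairing_bracket (α β : OneForm E M) (Z : VField E M) :
    pairing (A.bracket α β) Z =
      act (sharp A.Λ α) (pairing β Z) - pairing β (lieBracket (sharp A.Λ α) Z) -
      (act (sharp A.Λ β) (pairing α Z) - pairing α (lieBracket (sharp A.Λ β) Z)) -
      act Z (pairing β (sharp A.Λ α)) + A.φ.eval₃ (sharp A.Λ α) (sharp A.Λ β) Z +
      pairing β (sharp A.Λ α) * pairing A.θ Z := by
  rw [ATPStructure.bracket, koszulBracket, pairing_add_left, pairing_add_left, pairing_sub_left,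
    pairing_sub_left, pairing_lieDeriv, pairing_lieDeriv, pairing_diff, evalForms_pair,
    pairing_interior_interior, pairing_fsmul_left]

theorem ATPStructure.bracket_swap (α β : OneForm E M) : A.bracket β α = -A.bracket α β := by
  refine OneForm.ext_pairing fun Z => ?_
  change _ = -pairing (A.bracket α β) Z
  rw [A.pairing_bracket, A.pairing_bracket, pairing_sharp_swap A.Λ β α, act_neg,
    A.φ.eval₃_swap (sharp A.Λ β)]
  ring

theorem ATPStructure.bracket_add_right (α β γ : OneForm E M) :
    A.bracket α (β + γ) = A.bracket α β + A.bracket α γ := by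
  refine OneForm.ext_pairing fun Z => ?_
  simp only [pairing_add_left, A.pairing_bracket, sharp_add, lieBracket_add_left,
    pairing_add_right, act_add, A.φ.eval₃_rotate (sharp A.Λ α), KForm.eval₃_add_left]
  simp only [act, pairing_add_right]
  ring

/-- The terms with $Z(f)$ coming from $\mathcal L_{\Lambda^\#(f\beta)}\alpha$ and from
$d(\Lambda(\alpha,f\beta))$ cancel by skew-symmetry of $\Lambda$; the $\varphi$ and $\theta$ terms
are tensorial. -/
theorem ATPStructure.bracket_fsmul_right (f : SmoothFun E M) (α β : OneForm E M) :
    A.bracket α (fsmul f β) = fsmul f (A.bracket α β) + fsmul (act (sharp A.Λ α) f) β := by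
  refine OneForm.ext_pairing fun Z => ?_
  simp only [pairing_add_left, pairing_fsmul_left, A.pairing_bracket, sharp_fsmul,
    lieBracket_fsmul_left, pairing_sub_right, pairing_fsmul_right, act_mul,
    A.φ.eval₃_rotate (sharp A.Λ α), KForm.eval₃_fsmul_left]
  rw [pairing_sharp_swap A.Λ β α]
  simp only [act, pairing_fsmul_right]
  ring

theorem ATPStructure.bracket_add_left (α β γ : OneForm E M) :
    A.bracket (α + β) γ = A.bracket α γ + A.bracket β γ := by
  rw [A.bracket_swap γ, A.bracket_add_right, A.bracket_swap γ α, A.bracket_swap γ β]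
  abel_nf

theorem ATPStructure.bracket_fsmul_left (f : SmoothFun E M) (α β : OneForm E M) :
    A.bracket (fsmul f α) β = fsmul f (A.bracket α β) - fsmul (act (sharp A.Λ β) f) α := by
  rw [A.bracket_swap β, A.bracket_fsmul_right, A.bracket_swap α β]
  refine OneForm.ext_pairing fun Z => ?_
  change -(f * -pairing (A.bracket α β) Z + act (sharp A.Λ β) f * pairing α Z) =
    f * pairing (A.bracket α β) Z - act (sharp A.Λ β) f * pairing α Z
  ring

/-- The form in which $\tfrac12[\Lambda,\Lambda]=\Lambda^\#(\varphi)$ is used: both sides of that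
equation carry a minus sign, and here the two have been cancelled. -/
theorem ATPStructure.act_act_cyclic (f g h : SmoothFun E M) :
    act (sharp A.Λ (diff (act (sharp A.Λ (diff f)) g))) h +
        act (sharp A.Λ (diff (act (sharp A.Λ (diff g)) h))) f +
        act (sharp A.Λ (diff (act (sharp A.Λ (diff h)) f))) g =
      A.φ.eval₃ (sharp A.Λ (diff f)) (sharp A.Λ (diff g)) (sharp A.Λ (diff h)) := by
  ext x
  have := A.schouten_Λ ![f, g, h] x
  rw [schouten_self, evalForms_sharpForm] at this
  exact neg_injective this

end Brackets

/-! ### The Lie algebroid axioms: anchor morphism and Jacobi identity. -/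

section LieAlgebroid

variable {E : Type*} [NormedAddCommGroup E] [NormedSpace ℝ E] [FiniteDimensional ℝ E]
  {M : Type*} [TopologicalSpace M] [ChartedSpace E M] [IsManifold 𝓘(ℝ, E) ∞ M] [T2Space M]
  (A : ATPStructure E M)

theorem pairing_neg_left (a : OneForm E M) (X : VField E M) : pairing (-a) X = -pairing a X := rfl

theorem KForm.eval₃_neg_left (φ : KForm E M 3) (X Y Z : VField E M) :
    φ.eval₃ (-X) Y Z = -φ.eval₃ X Y Z := by
  have h := φ.eval₃_add_left X (-X) Y Z
  have h0 : φ.eval₃ 0 Y Z = 0 := by simpa using φ.eval₃_add_left 0 0 Y Z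
  rw [add_neg_cancel, h0] at h
  exact (neg_eq_of_add_eq_zero_right h.symm).symm

/-- A biadditive map on 1-forms, linear over smooth functions at `x`, that vanishes on
differentials vanishes. -/
theorem bilinear_eq_zero_of_diff {N : Type*} [AddCommGroup N] [Module ℝ N] {x : M}
    {T : OneForm E M → OneForm E M → N}
    (hadd₁ : ∀ a b c, T (a + b) c = T a c + T b c)
    (hsmul₁ : ∀ (f : SmoothFun E M) a b, T (fsmul f a) b = f x • T a b)
    (hadd₂ : ∀ a b c, T a (b + c) = T a b + T a c)
    (hsmul₂ : ∀ (f : SmoothFun E M) a b, T a (fsmul f b) = f x • T a b)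
    (h : ∀ f g, T (diff f) (diff g) = 0) (a b : OneForm E M) : T a b = 0 := by
  -- `T a b` depends only on the values of `a` and `b` at `x`, and these are values of
  -- differentials.
  obtain ⟨f, hf⟩ := exists_diff_apply_eq (a x)
  obtain ⟨g, hg⟩ := exists_diff_apply_eq (b x)
  rw [tensorial_congr (T := fun a => T a b) (x := x) (fun _ _ => hadd₁ _ _ _)
    (fun _ _ => hsmul₁ _ _ _) hf.symm,
    tensorial_congr (T := T (diff f)) (x := x) (fun _ _ => hadd₂ _ _ _)
    (fun _ _ => hsmul₂ _ _ _) hg.symm, h]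

theorem ATPStructure.pairing_theta_sharp (α : OneForm E M) : pairing A.θ (sharp A.Λ α) = 0 := by
  rw [pairing_sharp_swap, A.sharp_θ]
  ext x
  exact (congrArg Neg.neg (map_zero (α x))).trans neg_zero

/-- Tested on a function $h$, the $\theta$ term drops out because $\theta$ kills the image of
$\Lambda^\#$, and the $\varphi$ term is exactly the failure of the Jacobi identity for
$\{\cdot,\cdot\}$. -/
theorem ATPStructure.sharp_bracket_diff (f g : SmoothFun E M) :
    sharp A.Λ (A.bracket (diff f) (diff g)) =
      lieBracket (sharp A.Λ (diff f)) (sharp A.Λ (diff g)) := by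
  refine VField.ext_act fun h => ?_
  have hs (u v : SmoothFun E M) : act (sharp A.Λ (diff u)) v = -act (sharp A.Λ (diff v)) u :=
    pairing_sharp_swap A.Λ (diff u) (diff v)
  have key := A.act_act_cyclic f g h
  rw [act, pairing_sharp_swap, A.pairing_bracket, A.pairing_theta_sharp]
  simp only [pairing_diff, act_lieBracket]
  rw [hs (act _ _) h, hs (act _ _) f, hs (act _ _) g, hs h f, act_neg] at key
  rw [hs h f, hs h g, hs g f]
  simp only [act_neg]
  linear_combination key

/-- Both sides obey the same Leibniz rules, so their difference is tensorial and can be tested on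
differentials. -/
theorem ATPStructure.sharp_bracket (α β : OneForm E M) :
    sharp A.Λ (A.bracket α β) = lieBracket (sharp A.Λ α) (sharp A.Λ β) := by
  ext1 x
  rw [← sub_eq_zero]
  refine bilinear_eq_zero_of_diff (x := x) (T := fun α β => sharp A.Λ (A.bracket α β) x -
    lieBracket (sharp A.Λ α) (sharp A.Λ β) x) ?_ ?_ ?_ ?_ ?_ α β
  · intro a b c
    simp only [A.bracket_add_left, sharp_add, lieBracket_add_left]
    exact add_sub_add_comm _ _ _ _
  · intro f a b
    simp only [A.bracket_fsmul_left, sub_eq_add_neg, sharp_add, sharp_neg, sharp_fsmul,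
      lieBracket_fsmul_left]
    change f x • sharp A.Λ (A.bracket a b) x + -(act (sharp A.Λ b) f x • sharp A.Λ a x) +
      -(f x • lieBracket (sharp A.Λ a) (sharp A.Λ b) x +
        -(act (sharp A.Λ b) f x • sharp A.Λ a x)) = _
    rw [smul_add, smul_neg]
    abel
  · intro a b c
    simp only [A.bracket_add_right, sharp_add, lieBracket_add_right]
    exact add_sub_add_comm _ _ _ _
  · intro f a b
    simp only [A.bracket_fsmul_right, sharp_add, sharp_fsmul, lieBracket_fsmul_right]
    change f x • sharp A.Λ (A.bracket a b) x + act (sharp A.Λ a) f x • sharp A.Λ b x -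
      (act (sharp A.Λ a) f x • sharp A.Λ b x +
        f x • lieBracket (sharp A.Λ a) (sharp A.Λ b) x) = _
    rw [smul_sub]
    abel
  · intro f g
    simp only [A.sharp_bracket_diff, sub_self]

theorem ATPStructure.act_sharp_bracket (α β : OneForm E M) (f : SmoothFun E M) :
    act (sharp A.Λ (A.bracket α β)) f =
      act (sharp A.Λ α) (act (sharp A.Λ β) f) - act (sharp A.Λ β) (act (sharp A.Λ α) f) := by
  rw [A.sharp_bracket, act_lieBracket]

theorem ATPStructure.bracket_neg_left (α β : OneForm E M) : A.bracket (-α) β = -A.bracket α β := by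
  have h := A.bracket_add_left α (-α) β
  have h0 : A.bracket 0 β = 0 := by simpa using A.bracket_add_left 0 0 β
  rw [add_neg_cancel, h0] at h
  exact (neg_eq_of_add_eq_zero_right h.symm).symm

theorem ATPStructure.bracket_sub_left (α β γ : OneForm E M) :
    A.bracket (α - β) γ = A.bracket α γ - A.bracket β γ := by
  rw [sub_eq_add_neg, bracket_add_left, bracket_neg_left, sub_eq_add_neg]

/-- The Jacobiator of the bracket of 1-forms. -/
def ATPStructure.jacobiator (α β γ : OneForm E M) : OneForm E M :=
  A.bracket (A.bracket α β) γ + A.bracket (A.bracket β γ) α + A.bracket (A.bracket γ α) β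

theorem ATPStructure.jacobiator_rotate (α β γ : OneForm E M) :
    A.jacobiator α β γ = A.jacobiator β γ α := by
  simp only [jacobiator]
  abel

theorem ATPStructure.jacobiator_add (α α' β γ : OneForm E M) :
    A.jacobiator (α + α') β γ = A.jacobiator α β γ + A.jacobiator α' β γ := by
  simp only [jacobiator, bracket_add_left, bracket_add_right]
  abel

/-- The second derivatives of $f$ cancel because the anchor respects brackets; the remaining first
derivatives cancel by skew-symmetry of the bracket. -/
theorem ATPStructure.jacobiator_fsmul (f : SmoothFun E M) (α β γ : OneForm E M) :
    A.jacobiator (fsmul f α) β γ = fsmul f (A.jacobiator α β γ) := by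
  refine OneForm.ext_pairing fun Z => ?_
  have h := congrArg (fun a => pairing a Z) (A.bracket_swap γ α)
  simp only [pairing_neg_left] at h
  simp only [jacobiator, bracket_fsmul_left, bracket_fsmul_right, bracket_add_left,
    bracket_sub_left, pairing_add_left, pairing_sub_left, pairing_fsmul_left, act_sharp_bracket]
  linear_combination (-act (sharp A.Λ β) f) * h

/-- This is $\mathcal L_{\Lambda^\#(\alpha)}\theta=0$, by Cartan's formula from $d\theta=0$ and
$\theta(\Lambda^\#(\alpha))=0$. -/
theorem ATPStructure.pairing_theta_lieBracket_sharp (α : OneForm E M) (Z : VField E M) :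
    pairing A.θ (lieBracket (sharp A.Λ α) Z) = act (sharp A.Λ α) (pairing A.θ Z) := by
  ext x
  have h := A.closed_θ (sharp A.Λ α) Z x
  rw [A.pairing_theta_sharp] at h
  have h0 : mvfderiv 𝓘(ℝ, E) (0 : SmoothFun E M) x (Z x) = 0 :=
    congrArg (fun f : SmoothFun E M => f x) (act_zero Z)
  rw [h0, sub_zero, sub_eq_zero] at h
  exact h.symm

/-- For an exact second argument, $\mathcal L_{\Lambda^\#(\gamma)}dh=d(\Lambda(\gamma,dh))$, so two
of the three Koszul terms cancel. -/
theorem ATPStructure.pairing_bracket_diff_right (γ : OneForm E M) (h : SmoothFun E M)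
    (Z : VField E M) :
    pairing (A.bracket γ (diff h)) Z =
      -(act (sharp A.Λ (diff h)) (pairing γ Z) - pairing γ (lieBracket (sharp A.Λ (diff h)) Z)) +
      A.φ.eval₃ (sharp A.Λ γ) (sharp A.Λ (diff h)) Z +
      act (sharp A.Λ γ) h * pairing A.θ Z := by
  rw [A.pairing_bracket]
  simp only [pairing_diff, act_lieBracket]
  ring

theorem ATPStructure.pairing_bracket_diff (f g : SmoothFun E M) (Z : VField E M) :
    pairing (A.bracket (diff f) (diff g)) Z =
      act Z (act (sharp A.Λ (diff f)) g) +
      A.φ.eval₃ (sharp A.Λ (diff f)) (sharp A.Λ (diff g)) Z +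
      act (sharp A.Λ (diff f)) g * pairing A.θ Z := by
  have hs : act (sharp A.Λ (diff g)) f = -act (sharp A.Λ (diff f)) g :=
    pairing_sharp_swap A.Λ (diff g) (diff f)
  rw [A.pairing_bracket_diff_right]
  simp only [pairing_diff, act_lieBracket, hs, act_neg]
  ring

/-- Bracket $d\{f,g\}+i_{\Lambda^\#dg}i_{\Lambda^\#df}\varphi+\{f,g\}\theta$ with $dh$. Since
$\mathcal L_{\Lambda^\#dh}\theta=0$, the last summand contributes only a derivative of its
coefficient. -/
theorem ATPStructure.pairing_bracket_bracket_diff (f g h : SmoothFun E M) (Z : VField E M) :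
    pairing (A.bracket (A.bracket (diff f) (diff g)) (diff h)) Z =
      -act Z (act (sharp A.Λ (diff h)) (act (sharp A.Λ (diff f)) g)) -
      act (sharp A.Λ (diff h)) (A.φ.eval₃ (sharp A.Λ (diff f)) (sharp A.Λ (diff g)) Z) +
      A.φ.eval₃ (sharp A.Λ (diff f)) (sharp A.Λ (diff g)) (lieBracket (sharp A.Λ (diff h)) Z) +
      A.φ.eval₃ (lieBracket (sharp A.Λ (diff f)) (sharp A.Λ (diff g))) (sharp A.Λ (diff h)) Z +
      (act (sharp A.Λ (diff f)) (act (sharp A.Λ (diff g)) h) -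
        act (sharp A.Λ (diff g)) (act (sharp A.Λ (diff f)) h) -
        act (sharp A.Λ (diff h)) (act (sharp A.Λ (diff f)) g)) * pairing A.θ Z := by
  rw [A.pairing_bracket_diff_right, A.pairing_bracket_diff, A.pairing_bracket_diff]
  simp only [A.sharp_bracket, A.pairing_theta_lieBracket_sharp, act_lieBracket, act_add, act_mul]
  ring

/-- The cyclic sum combines three facts: the $Z$-derivative of `act_act_cyclic` for the exact part,
$d\varphi=\theta\wedge\varphi$ for the derivatives of $\varphi$, and $\theta(Z)$ times
`act_act_cyclic` for the $\theta$ part. -/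
theorem ATPStructure.jacobiator_diff (f g h : SmoothFun E M) :
    A.jacobiator (diff f) (diff g) (diff h) = 0 := by
  refine OneForm.ext_pairing fun Z => ?_
  have hs (u v : SmoothFun E M) : act (sharp A.Λ (diff u)) v = -act (sharp A.Λ (diff v)) u :=
    pairing_sharp_swap A.Λ (diff u) (diff v)
  have cyc := A.act_act_cyclic f g h
  rw [hs (act _ _) h, hs (act _ _) f, hs (act _ _) g] at cyc
  have dcyc := congrArg (act Z) cyc
  simp only [act_add, act_neg] at dcyc
  -- Of the four terms of $\theta\wedge\varphi$ only the one with $\theta(Z)$ survives, since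
  -- $\theta$ vanishes on the other three arguments.
  have hdφ : act (sharp A.Λ (diff f)) (A.φ.eval₃ (sharp A.Λ (diff g)) (sharp A.Λ (diff h)) Z) -
      act (sharp A.Λ (diff g)) (A.φ.eval₃ (sharp A.Λ (diff f)) (sharp A.Λ (diff h)) Z) +
      act (sharp A.Λ (diff h)) (A.φ.eval₃ (sharp A.Λ (diff f)) (sharp A.Λ (diff g)) Z) -
      act Z (A.φ.eval₃ (sharp A.Λ (diff f)) (sharp A.Λ (diff g)) (sharp A.Λ (diff h))) -
      A.φ.eval₃ (lieBracket (sharp A.Λ (diff f)) (sharp A.Λ (diff g))) (sharp A.Λ (diff h)) Z +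
      A.φ.eval₃ (lieBracket (sharp A.Λ (diff f)) (sharp A.Λ (diff h))) (sharp A.Λ (diff g)) Z -
      A.φ.eval₃ (lieBracket (sharp A.Λ (diff f)) Z) (sharp A.Λ (diff g)) (sharp A.Λ (diff h)) -
      A.φ.eval₃ (lieBracket (sharp A.Λ (diff g)) (sharp A.Λ (diff h))) (sharp A.Λ (diff f)) Z +
      A.φ.eval₃ (lieBracket (sharp A.Λ (diff g)) Z) (sharp A.Λ (diff f)) (sharp A.Λ (diff h)) -
      A.φ.eval₃ (lieBracket (sharp A.Λ (diff h)) Z) (sharp A.Λ (diff f)) (sharp A.Λ (diff g)) =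
      -(pairing A.θ Z *
        A.φ.eval₃ (sharp A.Λ (diff f)) (sharp A.Λ (diff g)) (sharp A.Λ (diff h))) := by
    ext x
    rw [← KForm.extDeriv_three, A.extDeriv_φ, KForm.oneWedge_three]
    simp only [A.pairing_theta_sharp, zero_mul, sub_zero, add_zero, zero_sub]
  simp only [jacobiator, pairing_add_left, pairing_bracket_bracket_diff]
  rw [hs f h, hs g f, hs h g,
    A.φ.eval₃_swap (sharp A.Λ (diff h)) (sharp A.Λ (diff f)) Z,
    A.φ.eval₃_swap (sharp A.Λ (diff h)) (sharp A.Λ (diff f)) (lieBracket _ Z),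
    ← A.φ.eval₃_rotate (lieBracket (sharp A.Λ (diff h)) Z),
    ← A.φ.eval₃_rotate (lieBracket (sharp A.Λ (diff f)) Z),
    ← A.φ.eval₃_rotate (lieBracket (sharp A.Λ (diff g)) Z),
    lieBracket_swap (sharp A.Λ (diff f)) (sharp A.Λ (diff h)), A.φ.eval₃_neg_left]
  simp only [act_neg]
  change _ = (0 : SmoothFun E M)
  linear_combination dcyc - hdφ - pairing A.θ Z * cyc

/-- The Jacobi identity. -/
theorem ATPStructure.jacobiator_eq_zero (α β γ : OneForm E M) : A.jacobiator α β γ = 0 := by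
  ext1 x
  obtain ⟨f, hf⟩ := exists_diff_apply_eq (γ x)
  refine bilinear_eq_zero_of_diff (x := x) (T := fun α β => A.jacobiator α β γ x) ?_ ?_ ?_ ?_ ?_ α β
  · intro a b c
    simp only [A.jacobiator_add]
    rfl
  · intro f a b
    simp only [A.jacobiator_fsmul]
    rfl
  · intro a b c
    simp only [A.jacobiator_rotate a, A.jacobiator_add]
    rfl
  · intro f a b
    simp only [A.jacobiator_rotate a, A.jacobiator_fsmul]
    rfl
  · intro u v
    -- The remaining slot is rotated to the front and there replaced by a differential with the same
    -- value at `x`.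
    have h1 := tensorial_congr (T := fun γ => A.jacobiator γ (diff u) (diff v) x) (x := x)
      (fun _ _ => by simp only [A.jacobiator_add]; rfl)
      (fun _ _ => by simp only [A.jacobiator_fsmul]; rfl) hf.symm
    simp only [A.jacobiator_diff] at h1
    rw [← A.jacobiator_rotate, h1]
    rfl

end LieAlgebroid

/-! ### Multivector fields as function-linear maps on 1-forms. -/

section MultiVectors

variable {E : Type*} [NormedAddCommGroup E] [NormedSpace ℝ E] [FiniteDimensional ℝ E]
  {M : Type*} [TopologicalSpace M] [ChartedSpace E M] [IsManifold 𝓘(ℝ, E) ∞ M] [T2Space M]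

/-- A map on `n`-tuples of 1-forms, additive and linear over smooth functions in each argument,
depends at every point only on the values of the forms there. -/
theorem multilinear_congr {n : ℕ} {N : Type*} [AddCommGroup N] [Module ℝ N] {x : M}
    {Φ : (Fin n → OneForm E M) → N}
    (hadd : ∀ α i a b, Φ (Function.update α i (a + b)) =
      Φ (Function.update α i a) + Φ (Function.update α i b))
    (hsmul : ∀ α i (f : SmoothFun E M) a, Φ (Function.update α i (fsmul f a)) =
      f x • Φ (Function.update α i a))
    {α β : Fin n → OneForm E M} (h : ∀ i, α i x = β i x) : Φ α = Φ β := by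
  -- The arguments are exchanged one at a time; `S` is the set of slots already exchanged.
  have key (S : Finset (Fin n)) : Φ (fun i => if i ∈ S then β i else α i) = Φ α := by
    induction S using Finset.induction_on with
    | empty => simp
    | insert j S hj ih =>
      rw [← ih]
      have h1 : (fun i => if i ∈ insert j S then β i else α i) =
          Function.update (fun i => if i ∈ S then β i else α i) j (β j) := by
        ext1 i
        by_cases hij : i = j
        · subst hij; simp
        · simp [hij]
      have h2 : (fun i => if i ∈ S then β i else α i) =
          Function.update (fun i => if i ∈ S then β i else α i) j (α j) := by
        ext1 i
        by_cases hij : i = j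
        · subst hij; simp [hj]
        · simp [hij]
      rw [h1]
      conv_rhs => rw [h2]
      exact tensorial_congr (T := fun a => Φ (Function.update _ j a)) (fun _ _ => hadd _ _ _ _)
        (fun _ _ => hsmul _ _ _ _) (h j).symm
  simpa using (key Finset.univ).symm

/-- A smooth alternating map on 1-forms which is linear over smooth functions comes from a
multivector field. -/
theorem exists_multiVec {F : Type*} [NormedField F] [NormedAlgebra ℝ F] {n : ℕ}
    (Φ : (Fin n → OneForm E M) → M → F)
    (hΦ : ∀ α, ContMDiff 𝓘(ℝ, E) 𝓘(ℝ, F) ∞ (Φ α))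
    (hadd : ∀ α i a b x, Φ (Function.update α i (a + b)) x =
      Φ (Function.update α i a) x + Φ (Function.update α i b) x)
    (hsmul : ∀ α i (f : SmoothFun E M) a x, Φ (Function.update α i (fsmul f a)) x =
      f x • Φ (Function.update α i a) x)
    (halt : ∀ α i j x, i ≠ j → α i = α j → Φ α x = 0) :
    ∃ P : MultiVec E M F n, ∀ α x, P.1 x (fun i => α i x) = Φ α x := by
  choose ext hext using fun (x : M) (v : TangentSpace 𝓘(ℝ, E) x →L[ℝ] ℝ) =>
    exists_section_covector v
  have congr (x : M) {α β : Fin n → OneForm E M} (h : ∀ i, α i x = β i x) : Φ α x = Φ β x :=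
    multilinear_congr (Φ := fun α => Φ α x) (fun α i a b => hadd α i a b x)
      (fun α i f a => hsmul α i f a x) h
  -- The chosen extensions are not linear in the covector. They may be traded for sums and multiples
  -- of extensions because only values at `x` matter.
  have hup (x : M) (m : Fin n → (TangentSpace 𝓘(ℝ, E) x →L[ℝ] ℝ)) (i : Fin n)
      (v : TangentSpace 𝓘(ℝ, E) x →L[ℝ] ℝ) (a : OneForm E M) (ha : a x = v) :
      Φ (fun j => ext x (Function.update m i v j)) x =
        Φ (Function.update (fun j => ext x (m j)) i a) x := by
    refine congr x fun j => ?_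
    rw [hext]
    by_cases hj : j = i
    · subst hj; simp [ha]
    · simp [hj, hext]
  let P : RawMultiVec E M F n := fun x =>
    { toFun := fun m => Φ (fun i => ext x (m i)) x
      map_update_add' := by
        intro inst m i v w
        rw [Subsingleton.elim inst (instDecidableEqFin n)]
        rw [hup x m i (v + w) (ext x v + ext x w), hup x m i v (ext x v) (hext x v),
          hup x m i w (ext x w) (hext x w), hadd]
        rw [ContMDiffSection.coe_add, Pi.add_apply, hext, hext]
      map_update_smul' := by
        intro inst m i c v
        rw [Subsingleton.elim inst (instDecidableEqFin n)]
        let f : SmoothFun E M := ⟨fun _ => c, contMDiff_const⟩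
        rw [hup x m i (c • v) (fsmul f (ext x v)),
          hup x m i v (ext x v) (hext x v), hsmul]
        · rfl
        · rw [fsmul_apply, hext]
          rfl
      map_eq_zero_of_eq' := fun m i j h hij => halt _ i j x hij (by rw [h]) }
  have hP (α : Fin n → OneForm E M) (x : M) : P x (fun i => α i x) = Φ α x :=
    congr x fun i => hext x (α i x)
  exact ⟨⟨P, fun α => (hΦ α).congr fun x => hP α x⟩, hP⟩

/-- A multivector field is determined by its values on smooth 1-forms. -/
theorem MultiVec.ext_forms {F : Type*} [NormedField F] [NormedAlgebra ℝ F] {n : ℕ}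
    {P Q : MultiVec E M F n}
    (h : ∀ (α : Fin n → OneForm E M) x, P.1 x (fun i => α i x) = Q.1 x (fun i => α i x)) :
    P = Q := by
  refine Subtype.ext (funext fun x => AlternatingMap.ext fun m => ?_)
  choose α hα using fun i => exists_section_covector (m i)
  rw [← funext hα]
  exact h α x

end MultiVectors

/-! ### The differential in degrees one and two, written out. -/

section Differential

variable {E : Type*} [NormedAddCommGroup E] [NormedSpace ℝ E] [FiniteDimensional ℝ E]
  {M : Type*} [TopologicalSpace M] [ChartedSpace E M] [IsManifold 𝓘(ℝ, E) ∞ M] [T2Space M]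
  (A : ATPStructure E M) {F : Type*} [NormedField F] [NormedAlgebra ℝ F]

theorem multiVec_two_eq {P : MultiVec E M F 2} {x : M}
    {v : Fin 2 → (TangentSpace 𝓘(ℝ, E) x →L[ℝ] ℝ)} {a b : TangentSpace 𝓘(ℝ, E) x →L[ℝ] ℝ}
    (ha : v 0 = a) (hb : v 1 = b) : P.1 x v = P.1 x ![a, b] := by
  refine congrArg (P.1 x) ?_
  ext1 i
  fin_cases i <;> assumption

theorem multiVec_one_eq {P : MultiVec E M F 1} {x : M}
    {v : Fin 1 → (TangentSpace 𝓘(ℝ, E) x →L[ℝ] ℝ)} {a : TangentSpace 𝓘(ℝ, E) x →L[ℝ] ℝ}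
    (ha : v 0 = a) : P.1 x v = P.1 x ![a] := by
  refine congrArg (P.1 x) ?_
  ext1 i
  fin_cases i
  exact ha

theorem ATPStructure.d_one (V : MultiVec E M F 1) (α : Fin 2 → OneForm E M) (x : M) :
    A.d F 1 V α x =
      mvfderiv 𝓘(ℝ, E) (fun y => V.1 y ![α 1 y]) x (sharp A.Λ (α 0) x) -
      mvfderiv 𝓘(ℝ, E) (fun y => V.1 y ![α 0 y]) x (sharp A.Λ (α 1) x) -
      V.1 x ![A.bracket (α 0) (α 1) x] := by
  change (∑ i : Fin 2, (-1 : F) ^ (i : ℕ) *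
          mvfderiv 𝓘(ℝ, E) (fun y => V.1 y (fun l => α (i.succAbove l) y)) x
            (sharp A.Λ (α i) x)) +
        (∑ j : Fin 2, ∑ i : Fin 1, if i.castSucc < j then
          (-1 : F) ^ ((i : ℕ) + (j : ℕ)) * V.1 x (Matrix.vecCons (A.bracket (α i.castSucc) (α j) x)
            (fun l => α (j.succAbove (i.succAbove l)) x)) else 0) = _
  rw [Fin.sum_univ_two, Fin.sum_univ_two, Fin.sum_univ_one, Fin.sum_univ_one, if_neg (by decide),
    if_pos (by decide),
    funext fun y => multiVec_one_eq (P := V) (v := fun l => α ((0 : Fin 2).succAbove l) y)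
      (a := α 1 y) rfl,
    funext fun y => multiVec_one_eq (P := V) (v := fun l => α ((1 : Fin 2).succAbove l) y)
      (a := α 0 y) rfl,
    multiVec_one_eq (P := V) (a := A.bracket (α 0) (α 1) x) rfl]
  simp
  ring

theorem ATPStructure.d_two (P : MultiVec E M F 2) (α : Fin 3 → OneForm E M) (x : M) :
    A.d F 2 P α x =
      mvfderiv 𝓘(ℝ, E) (fun y => P.1 y ![α 1 y, α 2 y]) x (sharp A.Λ (α 0) x) -
      mvfderiv 𝓘(ℝ, E) (fun y => P.1 y ![α 0 y, α 2 y]) x (sharp A.Λ (α 1) x) +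
      mvfderiv 𝓘(ℝ, E) (fun y => P.1 y ![α 0 y, α 1 y]) x (sharp A.Λ (α 2) x) -
      P.1 x ![A.bracket (α 0) (α 1) x, α 2 x] + P.1 x ![A.bracket (α 0) (α 2) x, α 1 x] -
      P.1 x ![A.bracket (α 1) (α 2) x, α 0 x] := by
  change (∑ i : Fin 3, (-1 : F) ^ (i : ℕ) *
          mvfderiv 𝓘(ℝ, E) (fun y => P.1 y (fun l => α (i.succAbove l) y)) x
            (sharp A.Λ (α i) x)) +
        (∑ j : Fin 3, ∑ i : Fin 2, if i.castSucc < j then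
          (-1 : F) ^ ((i : ℕ) + (j : ℕ)) * P.1 x (Matrix.vecCons (A.bracket (α i.castSucc) (α j) x)
            (fun l => α (j.succAbove (i.succAbove l)) x)) else 0) = _
  rw [Fin.sum_univ_three, Fin.sum_univ_three, Fin.sum_univ_two, Fin.sum_univ_two, Fin.sum_univ_two,
    if_neg (by decide), if_neg (by decide), if_pos (by decide), if_neg (by decide),
    if_pos (by decide), if_pos (by decide),
    funext fun y => multiVec_two_eq (P := P) (v := fun l => α ((0 : Fin 3).succAbove l) y)
      (a := α 1 y) (b := α 2 y) rfl rfl,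
    funext fun y => multiVec_two_eq (P := P) (v := fun l => α ((1 : Fin 3).succAbove l) y)
      (a := α 0 y) (b := α 2 y) rfl rfl,
    funext fun y => multiVec_two_eq (P := P) (v := fun l => α ((2 : Fin 3).succAbove l) y)
      (a := α 0 y) (b := α 1 y) rfl rfl,
    multiVec_two_eq (P := P)
      (v := Matrix.vecCons (A.bracket (α (Fin.castSucc (0 : Fin 2))) (α 1) x)
        (fun l => α ((1 : Fin 3).succAbove ((0 : Fin 2).succAbove l)) x))
      (a := A.bracket (α 0) (α 1) x) (b := α 2 x) rfl rfl,
    multiVec_two_eq (P := P)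
      (v := Matrix.vecCons (A.bracket (α (Fin.castSucc (0 : Fin 2))) (α 2) x)
        (fun l => α ((2 : Fin 3).succAbove ((0 : Fin 2).succAbove l)) x))
      (a := A.bracket (α 0) (α 2) x) (b := α 1 x) rfl rfl,
    multiVec_two_eq (P := P)
      (v := Matrix.vecCons (A.bracket (α (Fin.castSucc (1 : Fin 2))) (α 2) x)
        (fun l => α ((2 : Fin 3).succAbove ((1 : Fin 2).succAbove l)) x))
      (a := A.bracket (α 1) (α 2) x) (b := α 0 x) rfl rfl]
  simp [pow_succ]
  ring

end Differential

/-! ### Complex functions and multiplication operators on a line bundle. -/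

section LineBundles

variable {E : Type*} [NormedAddCommGroup E] [NormedSpace ℝ E] [FiniteDimensional ℝ E]
  {M : Type*} [TopologicalSpace M] [ChartedSpace E M] [IsManifold 𝓘(ℝ, E) ∞ M] [T2Space M]
  {K : M → Type*} [TopologicalSpace (Bundle.TotalSpace ℂ K)]
  [∀ x, AddCommGroup (K x)] [∀ x, Module ℂ (K x)] [∀ x, TopologicalSpace (K x)]
  [FiberBundle ℂ K] [VectorBundle ℂ ℂ K] [VectorBundle ℝ ℂ K]

@[simp]
theorem complex_smul_apply (c : ℂ) (s : Sections E K) (x : M) : (c • s) x = c • s x := rfl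

theorem mvfderiv_clm_comp {F G : Type*} [NormedAddCommGroup F] [NormedSpace ℝ F]
    [NormedAddCommGroup G] [NormedSpace ℝ G] (L : F →L[ℝ] G) {f : M → F} {x : M}
    (hf : MDifferentiableAt 𝓘(ℝ, E) 𝓘(ℝ, F) f x) (w : TangentSpace 𝓘(ℝ, E) x) :
    mvfderiv 𝓘(ℝ, E) (fun y => L (f y)) x w = L (mvfderiv 𝓘(ℝ, E) f x w) := by
  have h : mfderiv 𝓘(ℝ, E) 𝓘(ℝ, G) (fun y => L (f y)) x = _ :=
    ((L.hasMFDerivAt (x := f x)).comp x hf.hasMFDerivAt).mfderiv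
  exact congrArg (fun A => A w) h

/-- The real part of a smooth complex function. -/
def reFun (p : M → ℂ) (hp : ContMDiff 𝓘(ℝ, E) 𝓘(ℝ, ℂ) ∞ p) : SmoothFun E M :=
  ⟨fun y => (p y).re, Complex.reCLM.contDiff.contMDiff.comp hp⟩

/-- The imaginary part of a smooth complex function. -/
def imFun (p : M → ℂ) (hp : ContMDiff 𝓘(ℝ, E) 𝓘(ℝ, ℂ) ∞ p) : SmoothFun E M :=
  ⟨fun y => (p y).im, Complex.imCLM.contDiff.contMDiff.comp hp⟩

theorem act_reFun (p : M → ℂ) (hp : ContMDiff 𝓘(ℝ, E) 𝓘(ℝ, ℂ) ∞ p) (X : VField E M) (x : M) :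
    act X (reFun p hp) x = (mvfderiv 𝓘(ℝ, E) p x (X x)).re :=
  mvfderiv_clm_comp Complex.reCLM (hp.mdifferentiableAt (by simp)) (X x)

theorem act_imFun (p : M → ℂ) (hp : ContMDiff 𝓘(ℝ, E) 𝓘(ℝ, ℂ) ∞ p) (X : VField E M) (x : M) :
    act X (imFun p hp) x = (mvfderiv 𝓘(ℝ, E) p x (X x)).im :=
  mvfderiv_clm_comp Complex.imCLM (hp.mdifferentiableAt (by simp)) (X x)

theorem re_smul_add_I_smul_im_smul {x : M} (z : ℂ) (v : K x) :
    z.re • v + Complex.I • z.im • v = z • v := by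
  rw [← Complex.coe_smul, ← Complex.coe_smul, smul_smul, ← add_smul, mul_comm, Complex.re_add_im]

/-- The Leibniz rule of a contravariant derivative for complex functions. -/
theorem ContravariantDerivative.leibniz_complex {Λ : MultiVec E M ℝ 2}
    (D : ContravariantDerivative K Λ) (α : OneForm E M) {p : M → ℂ}
    (hp : ContMDiff 𝓘(ℝ, E) 𝓘(ℝ, ℂ) ∞ p) {s t : Sections E K} (h : ∀ y, t y = p y • s y) (x : M) :
    D.toFun α t x =
      p x • D.toFun α s x + mvfderiv 𝓘(ℝ, E) p x (sharp Λ α x) • s x := by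
  -- The given Leibniz rule is for real functions only; the imaginary part is reached through
  -- complex linearity of `D.toFun α`.
  have ht : t = fsmul (reFun p hp) s + Complex.I • fsmul (imFun p hp) s := by
    ext1 y
    rw [h]
    exact (re_smul_add_I_smul_im_smul (p y) (s y)).symm
  rw [ht, _root_.map_add, map_smul, D.leibniz, D.leibniz, pairing_diff, pairing_diff]
  change (p x).re • D.toFun α s x + act (sharp Λ α) (reFun p hp) x • s x +
    Complex.I • ((p x).im • D.toFun α s x + act (sharp Λ α) (imFun p hp) x • s x) = _
  rw [act_reFun, act_imFun, ← re_smul_add_I_smul_im_smul (p x),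
    ← re_smul_add_I_smul_im_smul (mvfderiv 𝓘(ℝ, E) p x (sharp Λ α x)) (s x), smul_add]
  abel

variable [ContMDiffVectorBundle ∞ ℂ K 𝓘(ℝ, E)]

/-- Near every point, there is a section equal to `1` in a trivialization. -/
theorem exists_section_trivialization_eq_one (x : M) :
    ∃ s : Sections E K, ∀ᶠ y in nhds x, (trivializationAt ℂ K x ⟨y, s y⟩).2 = 1 := by
  set e := trivializationAt ℂ K x with he
  have hx : x ∈ e.baseSet := FiberBundle.mem_baseSet_trivializationAt' x
  have h : ContMDiffOn 𝓘(ℝ, E) (𝓘(ℝ, E).prod 𝓘(ℝ, ℂ)) ∞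
      (fun y => Bundle.TotalSpace.mk' ℂ y (e.symm y 1)) e.baseSet := by
    rw [e.contMDiffOn_section_baseSet_iff]
    refine (contMDiffOn_const (c := (1 : ℂ))).congr fun y hy => ?_
    simp [e.apply_mk_symm hy]
  obtain ⟨t, ht⟩ := exists_section_eventuallyEq e.open_baseSet hx h
  refine ⟨t, ?_⟩
  filter_upwards [ht, e.open_baseSet.mem_nhds hx] with y hy hyb
  rw [hy, e.apply_mk_symm hyb]

theorem smul_eq_of_trivialization_eq_one {x y : M} (hy : y ∈ (trivializationAt ℂ K x).baseSet)
    {v : K y} (hv : (trivializationAt ℂ K x ⟨y, v⟩).2 = 1) (w : K y) :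
    w = (trivializationAt ℂ K x ⟨y, w⟩).2 • v := by
  set e := trivializationAt ℂ K x
  apply (e.linearEquivAt ℂ y hy).injective
  rw [map_smul]
  change (e ⟨y, w⟩).2 = (e ⟨y, w⟩).2 • (e ⟨y, v⟩).2
  rw [hv, smul_eq_mul, mul_one]

theorem exists_section_ne_zero (x : M) : ∃ s : Sections E K, s x ≠ 0 := by
  obtain ⟨s, hs⟩ := exists_section_trivialization_eq_one (E := E) (K := K) x
  refine ⟨s, fun h => ?_⟩
  have h1 := hs.self_of_nhds
  have hx : x ∈ (trivializationAt ℂ K x).baseSet := FiberBundle.mem_baseSet_trivializationAt' x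
  have h2 : (trivializationAt ℂ K x ⟨x, (0 : K x)⟩).2 = 0 :=
    map_zero ((trivializationAt ℂ K x).linearEquivAt ℂ x hx)
  rw [h, h2] at h1
  exact zero_ne_one h1

/-- An endomorphism of the space of sections of a line bundle that is linear over smooth functions
is the multiplication with a smooth complex function. -/
theorem exists_multiplier (T : Module.End ℂ (Sections E K))
    (hT : ∀ (f : SmoothFun E M) s, T (fsmul f s) = fsmul f (T s)) :
    ∃ c : M → ℂ, ContMDiff 𝓘(ℝ, E) 𝓘(ℝ, ℂ) ∞ c ∧ ∀ s x, T s x = c x • s x := by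
  have hcongr {x : M} {s t : Sections E K} (h : s x = t x) : T s x = T t x :=
    tensorial_congr (T := fun s => T s x) (fun _ _ => by rw [map_add]; rfl)
      (fun f s => by rw [hT]; rfl) h
  have hloc {x y : M} {s₀ : Sections E K} (hy : y ∈ (trivializationAt ℂ K x).baseSet)
      (hs₀ : (trivializationAt ℂ K x ⟨y, s₀ y⟩).2 = 1) (s : Sections E K) :
      T s y = (trivializationAt ℂ K x ⟨y, T s₀ y⟩).2 • s y := by
    have h1 := smul_eq_of_trivialization_eq_one hy hs₀ (s y)
    have h2 := smul_eq_of_trivialization_eq_one hy hs₀ (T s₀ y)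
    -- The coordinate of `s` at `y` is frozen to a constant, so complex linearity applies to it,
    -- while `T` sees only the value at `y`.
    have h3 : T s y = T ((trivializationAt ℂ K x ⟨y, s y⟩).2 • s₀) y := hcongr h1
    rw [map_smul, complex_smul_apply, h2, smul_comm, ← h1] at h3
    exact h3
  choose σ hσ using exists_section_trivialization_eq_one (E := E) (K := K)
  have hmem (x : M) : x ∈ (trivializationAt ℂ K x).baseSet :=
    FiberBundle.mem_baseSet_trivializationAt' x
  have hc (s : Sections E K) (x : M) :
      T s x = (trivializationAt ℂ K x ⟨x, T (σ x) x⟩).2 • s x :=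
    hloc (hmem x) (hσ x).self_of_nhds s
  refine ⟨fun x => (trivializationAt ℂ K x ⟨x, T (σ x) x⟩).2, fun x₀ => ?_, hc⟩
  -- The multiplier was read off at each point in that point's own trivialization. Near `x₀` it
  -- agrees with the coordinate of the single section `T (σ x₀)` in the fixed trivialization at
  -- `x₀`, which is smooth.
  refine ((Bundle.contMDiffAt_section x₀).mp ((T (σ x₀)).contMDiff x₀)).congr_of_eventuallyEq ?_
  filter_upwards [hσ x₀, (trivializationAt ℂ K x₀).open_baseSet.mem_nhds (hmem x₀)] with y h1 h2
  obtain ⟨s, hs⟩ := exists_section_ne_zero (E := E) (K := K) y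
  exact smul_left_injective ℂ hs ((hc s y).symm.trans (hloc h2 h1 s))

end LineBundles

/-! ### Curvature: existence, Bianchi identity, independence and Hermitian metrics. -/

section Curvature

variable {E : Type*} [NormedAddCommGroup E] [NormedSpace ℝ E] [FiniteDimensional ℝ E]
  {M : Type*} [TopologicalSpace M] [ChartedSpace E M] [IsManifold 𝓘(ℝ, E) ∞ M] [T2Space M]
  {K : M → Type*} [TopologicalSpace (Bundle.TotalSpace ℂ K)]
  [∀ x, AddCommGroup (K x)] [∀ x, Module ℂ (K x)] [∀ x, TopologicalSpace (K x)]
  [FiberBundle ℂ K] [VectorBundle ℂ ℂ K] [VectorBundle ℝ ℂ K]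
  {A : ATPStructure E M}

theorem ContravariantDerivative.map_neg {Λ : MultiVec E M ℝ 2} (D : ContravariantDerivative K Λ)
    (α : OneForm E M) : D.toFun (-α) = -D.toFun α :=
  _root_.map_neg (AddMonoidHom.mk' D.toFun D.map_add) α

theorem ContravariantDerivative.map_zero {Λ : MultiVec E M ℝ 2} (D : ContravariantDerivative K Λ) :
    D.toFun 0 = 0 :=
  _root_.map_zero (AddMonoidHom.mk' D.toFun D.map_add)

theorem fsmul_sub_right (f : SmoothFun E M) (s t : Sections E K) :
    fsmul f (s - t) = fsmul f s - fsmul f t := by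
  ext1 x
  exact smul_sub _ _ _

theorem fsmul_sub_left (f g : SmoothFun E M) (s : Sections E K) :
    fsmul (f - g) s = fsmul f s - fsmul g s := by
  ext1 x
  exact sub_smul _ _ _

theorem curvature_eq (D : ContravariantDerivative K A.Λ) (α β : OneForm E M) :
    curvature A D α β =
      D.toFun α * D.toFun β - D.toFun β * D.toFun α - D.toFun (A.bracket α β) := rfl

theorem curvature_apply (D : ContravariantDerivative K A.Λ) (α β : OneForm E M)
    (s : Sections E K) :
    curvature A D α β s =
      D.toFun α (D.toFun β s) - D.toFun β (D.toFun α s) - D.toFun (A.bracket α β) s := rfl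

theorem curvature_swap (D : ContravariantDerivative K A.Λ) (α β : OneForm E M) :
    curvature A D β α = -curvature A D α β := by
  rw [curvature_eq, curvature_eq, A.bracket_swap α β, D.map_neg]
  abel

theorem curvature_add_right (D : ContravariantDerivative K A.Λ) (α β γ : OneForm E M) :
    curvature A D α (β + γ) = curvature A D α β + curvature A D α γ := by
  simp only [curvature_eq, A.bracket_add_right, D.map_add, mul_add, add_mul]
  abel

theorem curvature_fsmul_right (D : ContravariantDerivative K A.Λ) (f : SmoothFun E M)
    (α β : OneForm E M) (s : Sections E K) :
    curvature A D α (fsmul f β) s = fsmul f (curvature A D α β s) := by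
  simp only [curvature_apply, A.bracket_fsmul_right, D.map_add, D.map_fsmul, D.leibniz,
    pairing_diff, LinearMap.add_apply, fsmul_sub_right]
  abel

/-- The commutator of $D_\alpha$ and $D_\beta$ differentiates $f$ along
$[\Lambda^\#(\alpha),\Lambda^\#(\beta)]$, and $D_{[\alpha,\beta]}$ along
$\Lambda^\#([\alpha,\beta])$; the anchor property makes these equal. -/
theorem curvature_fsmul (D : ContravariantDerivative K A.Λ) (f : SmoothFun E M)
    (α β : OneForm E M) (s : Sections E K) :
    curvature A D α β (fsmul f s) = fsmul f (curvature A D α β s) := by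
  simp only [curvature_apply, D.leibniz, _root_.map_add, pairing_diff, A.act_sharp_bracket,
    fsmul_sub_right, fsmul_sub_left]
  abel

variable [ContMDiffVectorBundle ∞ ℂ K 𝓘(ℝ, E)]

variable (K) in
theorem eq_of_smul_section_eq (x : M) {z w : ℂ}
    (h : ∀ s : Sections E K, z • s x = w • s x) : z = w := by
  obtain ⟨s, hs⟩ := exists_section_ne_zero (E := E) (K := K) x
  exact smul_left_injective ℂ hs (h s)

theorem IsCurvatureBivector.unique {D : ContravariantDerivative K A.Λ} {P Q : MultiVec E M ℂ 2}
    (hP : IsCurvatureBivector A D P) (hQ : IsCurvatureBivector A D Q) : P = Q := by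
  refine MultiVec.ext_forms fun α x => ?_
  obtain ⟨s, hs⟩ := exists_section_ne_zero (E := E) (K := K) x
  rw [multiVec_two_eq (P := P) (a := α 0 x) (b := α 1 x) rfl rfl,
    multiVec_two_eq (P := Q) (a := α 0 x) (b := α 1 x) rfl rfl]
  exact smul_left_injective ℂ hs ((hP (α 0) (α 1) s x).symm.trans (hQ (α 0) (α 1) s x))

theorem exists_isCurvatureBivector (D : ContravariantDerivative K A.Λ) :
    ∃ P : MultiVec E M ℂ 2, IsCurvatureBivector A D P := by
  choose c hc hcs using fun α β => exists_multiplier (curvature A D α β)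
    (fun f s => curvature_fsmul D f α β s)
  have hswap (α β : OneForm E M) (x : M) : c β α x = -c α β x := by
    refine eq_of_smul_section_eq (E := E) K x fun s => ?_
    rw [← hcs, curvature_swap, neg_smul, ← hcs]
    rfl
  have hadd (α β γ : OneForm E M) (x : M) : c α (β + γ) x = c α β x + c α γ x := by
    refine eq_of_smul_section_eq (E := E) K x fun s => ?_
    rw [← hcs, curvature_add_right, add_smul, ← hcs, ← hcs]
    rfl
  have hsmul (f : SmoothFun E M) (α β : OneForm E M) (x : M) :
      c α (fsmul f β) x = f x • c α β x := by
    refine eq_of_smul_section_eq (E := E) K x fun s => ?_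
    rw [← hcs, curvature_fsmul_right, smul_assoc, ← hcs]
    rfl
  obtain ⟨P, hP⟩ := exists_multiVec (E := E) (n := 2) (fun α => c (α 0) (α 1))
    (fun α => hc _ _)
    (by
      intro α i a b x
      fin_cases i
      · simp [hswap (α 1), hadd]; ring
      · simp [hadd])
    (by
      intro α i f a x
      fin_cases i
      · simp [hswap (α 1), hsmul]
      · simp [hsmul])
    (by
      intro α i j x hij h
      have h01 : α 0 = α 1 := by
        fin_cases i <;> fin_cases j <;> first | exact absurd rfl hij | exact h | exact h.symm
      have := hswap (α 0) (α 0) x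
      simp only [← h01]
      exact self_eq_neg.mp this)
  refine ⟨P, fun α β s x => ?_⟩
  rw [hcs, ← multiVec_two_eq (P := P) (v := fun i => ![α, β] i x) (a := α x) (b := β x) rfl rfl,
    hP]
  rfl

/-- The Bianchi identity: acting on a section, $\Lambda^\#(a)(P(b,c))$ is the commutator
$[D_a,C_D(b,c)]$, so $\partial P$ becomes an expression in operators. -/
theorem IsCurvatureBivector.mem_cocycles {D : ContravariantDerivative K A.Λ}
    {P : MultiVec E M ℂ 2} (hP : IsCurvatureBivector A D P) : P ∈ A.cocycles ℂ 2 := by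
  change A.d ℂ 2 P = 0
  ext α x
  obtain ⟨s, hs⟩ := exists_section_ne_zero (E := E) (K := K) x
  have hsm (a b : OneForm E M) : ContMDiff 𝓘(ℝ, E) 𝓘(ℝ, ℂ) ∞ (fun y => P.1 y ![a y, b y]) :=
    (P.2 ![a, b]).congr fun y => (multiVec_two_eq (P := P) (a := a y) (b := b y) rfl rfl).symm
  have hder (a b c : OneForm E M) :
      mvfderiv 𝓘(ℝ, E) (fun y => P.1 y ![b y, c y]) x (sharp A.Λ a x) • s x =
        (D.toFun a * curvature A D b c - curvature A D b c * D.toFun a) s x := by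
    have h := D.leibniz_complex a (hsm b c) (s := s) (t := curvature A D b c s)
      (fun y => hP b c s y) x
    rw [← hP b c (D.toFun a s) x] at h
    exact (sub_eq_of_eq_add' h).symm
  have hjac : D.toFun (A.bracket (A.bracket (α 0) (α 1)) (α 2)) -
      D.toFun (A.bracket (A.bracket (α 0) (α 2)) (α 1)) +
      D.toFun (A.bracket (A.bracket (α 1) (α 2)) (α 0)) = 0 := by
    have h := congrArg D.toFun (A.jacobiator_eq_zero (α 0) (α 1) (α 2))
    rw [ATPStructure.jacobiator, A.bracket_swap (α 0) (α 2), A.bracket_neg_left, D.map_add,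
      D.map_add, D.map_neg, D.map_zero] at h
    rw [← h]
    abel
  refine smul_left_injective ℂ hs ?_
  change A.d ℂ 2 P α x • s x = (0 : ℂ) • s x
  rw [zero_smul, A.d_two]
  simp only [sub_smul, add_smul, hder]
  rw [← hP, ← hP, ← hP]
  have hop : (D.toFun (α 0) * curvature A D (α 1) (α 2) - curvature A D (α 1) (α 2) * D.toFun (α 0))
      - (D.toFun (α 1) * curvature A D (α 0) (α 2) - curvature A D (α 0) (α 2) * D.toFun (α 1))
      + (D.toFun (α 2) * curvature A D (α 0) (α 1) - curvature A D (α 0) (α 1) * D.toFun (α 2))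
      - curvature A D (A.bracket (α 0) (α 1)) (α 2) + curvature A D (A.bracket (α 0) (α 2)) (α 1)
      - curvature A D (A.bracket (α 1) (α 2)) (α 0) = 0 := by
    -- With zero replaced by $D$ of the Jacobiator, the claim is an identity in the associative
    -- algebra of endomorphisms.
    rw [← hjac]
    simp only [curvature_eq]
    noncomm_ring
  exact congrArg (fun T : Module.End ℂ (Sections E K) => T s x) hop

/-- The difference of two contravariant derivatives is the multiplication with a vector field. -/
theorem exists_vector_of_difference (D D' : ContravariantDerivative K A.Λ) :
    ∃ V : MultiVec E M ℂ 1, ∀ (α : OneForm E M) (s : Sections E K) (x : M),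
      (D.toFun α - D'.toFun α) s x = V.1 x ![α x] • s x := by
  choose c hc hcs using fun α => exists_multiplier (D.toFun α - D'.toFun α) (fun f s => by
    simp only [LinearMap.sub_apply, D.leibniz, D'.leibniz, fsmul_sub_right]
    abel)
  have hadd (α β : OneForm E M) (x : M) : c (α + β) x = c α x + c β x := by
    refine eq_of_smul_section_eq (E := E) K x fun s => ?_
    rw [← hcs, D.map_add, D'.map_add, add_smul, ← hcs, ← hcs, add_sub_add_comm]
    rfl
  have hsmul (f : SmoothFun E M) (α : OneForm E M) (x : M) : c (fsmul f α) x = f x • c α x := by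
    refine eq_of_smul_section_eq (E := E) K x fun s => ?_
    rw [← hcs, smul_assoc, ← hcs, LinearMap.sub_apply, D.map_fsmul, D'.map_fsmul,
      ← fsmul_sub_right]
    rfl
  obtain ⟨V, hV⟩ := exists_multiVec (E := E) (n := 1) (fun α => c (α 0))
    (fun α => hc _)
    (by
      intro α i a b x
      rw [Subsingleton.elim i 0]
      simp [hadd])
    (by
      intro α i f a x
      rw [Subsingleton.elim i 0]
      simp [hsmul])
    (fun α i j x hij => absurd (Subsingleton.elim i j) hij)
  refine ⟨V, fun α s x => ?_⟩
  rw [hcs, ← multiVec_one_eq (P := V) (v := fun i => ![α] i x) (a := α x) rfl, hV]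
  rfl

/-- With $D=D'+V$ the curvatures differ by
$[D'_\alpha,V_\beta]-[D'_\beta,V_\alpha]-V_{[\alpha,\beta]}+[V_\alpha,V_\beta]$. The first three
terms are $\partial V$, and the last vanishes since multiplications on a line bundle commute. -/
theorem IsCurvatureBivector.sub_mem_coboundaries {D D' : ContravariantDerivative K A.Λ}
    {P P' : MultiVec E M ℂ 2} (hP : IsCurvatureBivector A D P)
    (hP' : IsCurvatureBivector A D' P') : P - P' ∈ A.coboundaries ℂ 2 := by
  obtain ⟨V, hV⟩ := exists_vector_of_difference D D'
  refine ⟨V, ?_⟩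
  ext α x
  obtain ⟨s, hs⟩ := exists_section_ne_zero (E := E) (K := K) x
  have hsm (a : OneForm E M) : ContMDiff 𝓘(ℝ, E) 𝓘(ℝ, ℂ) ∞ (fun y => V.1 y ![a y]) :=
    (V.2 ![a]).congr fun y => (multiVec_one_eq (P := V) (a := a y) rfl).symm
  have hder (a b : OneForm E M) :
      mvfderiv 𝓘(ℝ, E) (fun y => V.1 y ![b y]) x (sharp A.Λ a x) • s x =
        (D'.toFun a * (D.toFun b - D'.toFun b) - (D.toFun b - D'.toFun b) * D'.toFun a) s x := by
    have h := D'.leibniz_complex a (hsm b) (s := s) (t := (D.toFun b - D'.toFun b) s)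
      (fun y => hV b s y) x
    rw [← hV b (D'.toFun a s) x] at h
    exact (sub_eq_of_eq_add' h).symm
  have hcomm (a b : OneForm E M) : (D.toFun a - D'.toFun a) * (D.toFun b - D'.toFun b) =
      (D.toFun b - D'.toFun b) * (D.toFun a - D'.toFun a) := by
    refine LinearMap.ext fun t => ?_
    ext1 y
    simp only [Module.End.mul_apply, hV]
    exact smul_comm _ _ _
  refine smul_left_injective ℂ hs ?_
  change A.d ℂ 1 V α x • s x = (P - P').1 x (fun l => α l x) • s x
  rw [A.d_one, multiVec_two_eq (P := P - P') (a := α 0 x) (b := α 1 x) rfl rfl]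
  change _ = (P.1 x ![α 0 x, α 1 x] - P'.1 x ![α 0 x, α 1 x]) • s x
  simp only [sub_smul, hder]
  rw [← hP, ← hP', ← hV]
  have hop : (D'.toFun (α 0) * (D.toFun (α 1) - D'.toFun (α 1)) -
        (D.toFun (α 1) - D'.toFun (α 1)) * D'.toFun (α 0)) -
      (D'.toFun (α 1) * (D.toFun (α 0) - D'.toFun (α 0)) -
        (D.toFun (α 0) - D'.toFun (α 0)) * D'.toFun (α 1)) -
      (D.toFun (A.bracket (α 0) (α 1)) - D'.toFun (A.bracket (α 0) (α 1))) =
      curvature A D (α 0) (α 1) - curvature A D' (α 0) (α 1) := by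
    have h := sub_eq_zero.mpr (hcomm (α 0) (α 1))
    rw [← sub_eq_zero, ← neg_eq_zero, ← h]
    simp only [curvature_eq]
    noncomm_ring
  exact congrArg (fun T : Module.End ℂ (Sections E K) => T s x) hop

/-- The real part `Re h(s, t)` of a Hermitian metric as a smooth function. -/
def HermitianMetric.rePairing (h : HermitianMetric E K) (s t : Sections E K) : SmoothFun E M :=
  reFun (fun x => h.toFun x (s x) (t x)) (h.smooth' s t)

theorem IsCompatible.act_rePairing {Λ : MultiVec E M ℝ 2} {D : ContravariantDerivative K Λ}
    {h : HermitianMetric E K} (hD : IsCompatible D h) (α : OneForm E M) (s t : Sections E K) :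
    act (sharp Λ α) (h.rePairing s t) =
      h.rePairing (D.toFun α s) t + h.rePairing s (D.toFun α t) := by
  ext x
  rw [HermitianMetric.rePairing, act_reFun, hD α s t x, Complex.add_re]
  rfl

/-- Differentiate $\operatorname{Re}h(s,s)$ along $\Lambda^\#([\alpha,\beta])$ directly and as a
commutator. The mixed terms $h(D_\alpha s,D_\beta s)$ cancel and leave
$\operatorname{Re}\bigl(h(C_Ds,s)+h(s,C_Ds)\bigr)=0$, that is, $2\operatorname{Re}(P)\,h(s,s)=0$. -/
theorem IsCurvatureBivector.isPurelyImaginary {D : ContravariantDerivative K A.Λ}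
    {h : HermitianMetric E K} {P : MultiVec E M ℂ 2} (hD : IsCompatible D h)
    (hP : IsCurvatureBivector A D P) : IsPurelyImaginary P := by
  intro x a
  choose α hα using fun i => exists_section_covector (a i)
  obtain ⟨s, hs⟩ := exists_section_ne_zero (E := E) (K := K) x
  have h1 := congrArg (fun f : SmoothFun E M => f x)
    (A.act_sharp_bracket (α 0) (α 1) (h.rePairing s s))
  simp only [hD.act_rePairing, act_add] at h1
  have hre (u v : Sections E K) : h.rePairing u v x = (h.toFun x (u x) (v x)).re := rfl
  change (h.rePairing _ s x + h.rePairing s _ x) =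
    ((h.rePairing _ s x + h.rePairing _ _ x) + (h.rePairing _ _ x + h.rePairing s _ x)) -
    ((h.rePairing _ s x + h.rePairing _ _ x) + (h.rePairing _ _ x + h.rePairing s _ x)) at h1
  have h2 := hP (α 0) (α 1) s x
  have h3 : h.rePairing (curvature A D (α 0) (α 1) s) s x +
      h.rePairing s (curvature A D (α 0) (α 1) s) x = 0 := by
    rw [hre, hre, curvature_apply]
    simp only [hre] at h1
    simp only [ContMDiffSection.coe_sub, Pi.sub_apply, map_sub, LinearMap.sub_apply,
      Complex.sub_re]
    linarith
  -- `h` is conjugate linear in its first slot, so the two terms carry $\overline P$ and $P$, and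
  -- their imaginary contributions cancel in the sum.
  rw [hre, hre, h2, map_smulₛₗ, LinearMap.smul_apply, map_smul, smul_eq_mul, smul_eq_mul,
    Complex.mul_re, Complex.mul_re, Complex.conj_re, Complex.conj_im] at h3
  have h4 := h.pos x (s x) hs
  rw [multiVec_two_eq (P := P) (a := α 0 x) (b := α 1 x) (hα 0).symm (hα 1).symm]
  have h5 : (P.1 x ![α 0 x, α 1 x]).re * (h.toFun x (s x) (s x)).re = 0 := by linarith
  exact (mul_eq_zero.mp h5).resolve_right h4.ne'

end Curvature

end AlmostTwistedPoisson

end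

theorem theorem3p1
    {E : Type*} [NormedAddCommGroup E] [NormedSpace ℝ E] [FiniteDimensional ℝ E]
    {M : Type*} [TopologicalSpace M] [T2Space M] [SecondCountableTopology M]
    [ChartedSpace E M] [IsManifold 𝓘(ℝ, E) ∞ M]
    (A : AlmostTwistedPoisson.ATPStructure E M)
    (K : M → Type*) [TopologicalSpace (Bundle.TotalSpace ℂ K)]
    [∀ x, AddCommGroup (K x)] [∀ x, Module ℂ (K x)] [∀ x, TopologicalSpace (K x)]
    [FiberBundle ℂ K] [VectorBundle ℂ ℂ K] [VectorBundle ℝ ℂ K]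
    [ContMDiffVectorBundle ∞ ℂ K 𝓘(ℝ, E)] :
    -- the complex bivector field of a contravariant derivative exists and is unique
    (∀ D : AlmostTwistedPoisson.ContravariantDerivative K A.Λ,
      ∃! P : AlmostTwistedPoisson.MultiVec E M ℂ 2,
        AlmostTwistedPoisson.IsCurvatureBivector A D P) ∧
    -- it is closed, hence defines a class in the complex cohomology of degree two
    (∀ (D : AlmostTwistedPoisson.ContravariantDerivative K A.Λ)
      (P : AlmostTwistedPoisson.MultiVec E M ℂ 2),
      AlmostTwistedPoisson.IsCurvatureBivector A D P → P ∈ A.cocycles ℂ 2) ∧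
    -- the class does not depend on the contravariant derivative
    (∀ (D D' : AlmostTwistedPoisson.ContravariantDerivative K A.Λ) (P P' : A.cocycles ℂ 2),
      AlmostTwistedPoisson.IsCurvatureBivector A D P →
      AlmostTwistedPoisson.IsCurvatureBivector A D' P' →
      A.cohomologyClass P = A.cohomologyClass P') ∧
    -- if the derivative is compatible with a Hermitian metric, then it is purely imaginary
    (∀ (D : AlmostTwistedPoisson.ContravariantDerivative K A.Λ)
      (h : AlmostTwistedPoisson.HermitianMetric E K)
      (P : AlmostTwistedPoisson.MultiVec E M ℂ 2),
      AlmostTwistedPoisson.IsCompatible D h →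
      AlmostTwistedPoisson.IsCurvatureBivector A D P →
      AlmostTwistedPoisson.IsPurelyImaginary P) := by
  refine ⟨fun D => ?_, fun D P hP => hP.mem_cocycles, fun D D' P P' hP hP' => ?_,
    fun D h P hD hP => hP.isPurelyImaginary hD⟩
  · obtain ⟨P, hP⟩ := AlmostTwistedPoisson.exists_isCurvatureBivector D
    exact ⟨P, hP, fun Q hQ => hQ.unique hP⟩
  · exact (Submodule.Quotient.eq _).mpr (hP.sub_mem_coboundaries hP')
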